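/- Notation. For $a\in\mathbb C$ and $r\in\mathbb N_0$ let $(a)_r=a(a+1)\cdots(a+r-1)$, $(a)_0=1$. Let ${}_pF_q$ be the generalized hypergeometric series, ${}_pF_q[a_1,\dots,a_p;b_1,\dots,b_q\,|\,z]=\sum_{s\ge0}\frac{(a_1)_s\cdots(a_p)_s}{(b_1)_s\cdots(b_q)_s}\frac{z^s}{s!}$. The following are instances of the Kampé de Fériet function, of Srivastava's triple hypergeometric function $F^{(3)}$ and of the Srivastava $S$-function: $$F^{1:1;1}_{1:1;1}\left[\begin{array}{c}d:a;b\\ e:a';b'\end{array}\Big|\,x,y\right]=\sum_{p,q\ge0}\frac{(d)_{p+q}(a)_p(b)_q}{(e)_{p+q}(a')_p(b')_q}\frac{x^p}{p!}\frac{y^q}{q!},$$ $$F^{(3)}\left[\begin{array}{c}d::-;-;-:-;a;b\\ e::-;-;-:-;a';b'\end{array}\Big|\,x,y,z\right]=\sum_{r,p,q\ge0}\frac{(d)_{r+p+q}(a)_p(b)_q}{(e)_{r+p+q}(a')_p(b')_q}\frac{x^r}{r!}\frac{y^p}{p!}\frac{z^q}{q!},$$ $$\mathcal S^{1:0;2}_{1:0;3}\left[\begin{array}{c}[d:1,2]:-;a_1,a_2\\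 [e:1,2]:-;b_1,b_2,b_3\end{array}\Big|\,x,y\right]=\sum_{r,s\ge0}\frac{(d)_{r+2s}(a_1)_s(a_2)_s}{(e)_{r+2s}(b_1)_s(b_2)_s(b_3)_s}\frac{x^r}{r!}\frac{y^s}{s!}.$$ $F^{1:1;1}_{0:1;1}$, $\mathcal S^{1:0;2}_{0:0;3}$ and the $F^{(3)}$ with $-$ in place of $e$ are obtained by omitting the factor $(e)_{\cdot}$ from the denominators. Theorem 3. Let $m,n\in\mathbb N_0$, let $d,e\in\mathbb C$ with $\Re(e)>\Re(d)>0$, and let $\alpha,\beta\in\mathbb C$ be such that no denominator below vanishes, that is: none of $2\alpha+m$, $2\beta-n$, $\alpha+\frac12$, $\beta-n+\frac12$, $\alpha+\beta-n$ is $0$ or a negative integer, $\alpha-\frac12\notin\{0,-1,\dots,-(m-1)\}$ and $\beta-n-\frac12\notin\{0,-1,\dots,-(n-1)\}$. For $0\le j\le m$, $0\le k\le n$ put $$C_{j,k}=\frac{(-1)^k(-m)_j(-n)_k(2\alpha-1)_j(2\beta-2n-1)_k}{(2\alpha+m)_j(2\beta-n)_k(\alpha-\frac12)_j(\beta-n-\frac12)_k\,2^{2j+2k}\,j!\,k!},$$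 and $\sigma=\alpha+\beta+j+k-n$. All series below converge absolutely for the stated $x\in\mathbb C$, and the following hold. (i) For all $x\in\mathbb C$, $$F^{1:1;1}_{1:1;1}\left[\begin{array}{c}d:\alpha;\beta\\ e:2\alpha+m;2\beta-n\end{array}\Big|\,x,x\right]=\sum_{j=0}^m\sum_{k=0}^n\frac{(d)_{j+k}}{(e)_{j+k}}C_{j,k}\,x^{j+k}\;\mathcal S^{1:0;2}_{1:0;3}\left[\begin{array}{c}[d+j+k:1,2]:-;\frac{\sigma}{2},\frac{\sigma+1}{2}\\ [e+j+k:1,2]:-;\alpha+j+\frac12,\beta+k-n+\frac12,\sigma\end{array}\Big|\,x,\frac{x^2}{4}\right].$$ (ii) For all $x\in\mathbb C$, $$F^{1:1;1}_{1:1;1}\left[\begin{array}{c}d:\alpha;\beta-n\\ e:2\alpha+m;2\beta-n\end{array}\Big|\,x,-x\right]=F^{(3)}\left[\begin{array}{c}d::-;-;-:-;\alpha;\beta\\ e::-;-;-:-;2\alpha+m;2\beta-n\end{array}\Big|\,-x,x,x\right]$$ $$=\sum_{j=0}^m\sum_{k=0}^n\frac{(d)_{j+k}}{(e)_{j+k}}C_{j,k}\,x^{j+k}\;{}_4F_5\left[\begin{array}{c}\frac{\sigma}{2},\frac{\sigma+1}{2},\frac{d+j+k}{2},\frac{d+j+k+1}{2}\\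 \alpha+j+\frac12,\beta+k-n+\frac12,\sigma,\frac{e+j+k}{2},\frac{e+j+k+1}{2}\end{array}\Big|\,\frac{x^2}{4}\right].$$ (iii) For $|x|<\frac12$, $$F^{1:1;1}_{0:1;1}\left[\begin{array}{c}d:\alpha;\beta\\ -:2\alpha+m;2\beta-n\end{array}\Big|\,x,x\right]=\sum_{j=0}^m\sum_{k=0}^n(d)_{j+k}\,C_{j,k}\,x^{j+k}\;\mathcal S^{1:0;2}_{0:0;3}\left[\begin{array}{c}[d+j+k:1,2]:-;\frac{\sigma}{2},\frac{\sigma+1}{2}\\ -:-;\alpha+j+\frac12,\beta+k-n+\frac12,\sigma\end{array}\Big|\,x,\frac{x^2}{4}\right].$$ (iv) For $|x|<\frac12$, $$F^{1:1;1}_{0:1;1}\left[\begin{array}{c}d:\alpha;\beta-n\\ -:2\alpha+m;2\beta-n\end{array}\Big|\,x,-x\right]=\sum_{j=0}^m\sum_{k=0}^n(d)_{j+k}\,C_{j,k}\,x^{j+k}\;{}_4F_3\left[\begin{array}{c}\frac{\sigma}{2},\frac{\sigma+1}{2},\frac{d+j+k}{2},\frac{d+j+k+1}{2}\\ \alpha+j+\frac12,\beta+k-n+\frac12,\sigma\end{array}\Big|\,x^2\right],$$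 and for $|x|<\frac13$ the left-hand side also equals $$F^{(3)}\left[\begin{array}{c}d::-;-;-:-;\alpha;\beta\\ -::-;-;-:-;2\alpha+m;2\beta-n\end{array}\Big|\,-x,x,x\right].$$ -/

import Mathlib

noncomputable section

/-- The Pochhammer symbol `(a)_n = a (a + 1) ⋯ (a + n - 1)`, with `(a)_0 = 1`. -/
def poch (a : ℂ) (n : ℕ) : ℂ := (ascPochhammer ℂ n).eval a

/-- `((a))_n = (a₁)_n ⋯ (a_A)_n` for a list of parameters; the empty product is `1`. -/
def pochProd (a : List ℂ) (n : ℕ) : ℂ := (a.map fun u => poch u n).prod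

/-- The weighted product `∏ (a_i)_{n θ_i}` over a list of pairs `(a_i, θ_i)`. -/
def pochProd₁ (a : List (ℂ × ℕ)) (n : ℕ) : ℂ := (a.map fun u => poch u.1 (n * u.2)).prod

/-- The weighted product `∏ (a_i)_{r θ_i + s φ_i}` over a list of triples `(a_i, θ_i, φ_i)`. -/
def pochProd₂ (a : List (ℂ × ℕ × ℕ)) (r s : ℕ) : ℂ :=
  (a.map fun u => poch u.1 (r * u.2.1 + s * u.2.2)).prod

/-- General term of the generalized hypergeometric series `ₚF_q[a; b | z]`. -/
def genHypTerm (a b : List ℂ) (z : ℂ) (n : ℕ) : ℂ :=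
  pochProd a n / pochProd b n * (z ^ n / (n.factorial : ℂ))

/-- The generalized hypergeometric function `ₚF_q[a; b | z]`. -/
def genHyp (a b : List ℂ) (z : ℂ) : ℂ := ∑' n : ℕ, genHypTerm a b z n

/-- General term of the Kampé de Fériet double series
`F[a : b; b' / c : d; d' | x, y]`. -/
def kdfTerm (a b b' c d d' : List ℂ) (x y : ℂ) (i : ℕ × ℕ) : ℂ :=
  pochProd a (i.1 + i.2) * pochProd b i.1 * pochProd b' i.2 /
      (pochProd c (i.1 + i.2) * pochProd d i.1 * pochProd d' i.2) *
    (x ^ i.1 / (i.1.factorial : ℂ)) * (y ^ i.2 / (i.2.factorial : ℂ))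

/-- The Kampé de Fériet function `F[a : b; b' / c : d; d' | x, y]`. -/
def kdf (a b b' c d d' : List ℂ) (x y : ℂ) : ℂ :=
  ∑' i : ℕ × ℕ, kdfTerm a b b' c d d' x y i

/-- General term of Srivastava's general triple hypergeometric series
`F⁽³⁾[a :: b; b'; b'' : c; c'; c'' / e :: g; g'; g'' : h; h'; h'' | x, y, z]`.
The lists `b, b', b''` (and `g, g', g''`) go with the index sums first + second,
second + third and third + first. -/
def tripleTerm (a b b' b'' c c' c'' e g g' g'' h h' h'' : List ℂ) (x y z : ℂ)
    (i : ℕ × ℕ × ℕ) : ℂ :=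
  (pochProd a (i.1 + i.2.1 + i.2.2) *
      pochProd b (i.1 + i.2.1) * pochProd b' (i.2.1 + i.2.2) * pochProd b'' (i.2.2 + i.1) *
      pochProd c i.1 * pochProd c' i.2.1 * pochProd c'' i.2.2) /
    (pochProd e (i.1 + i.2.1 + i.2.2) *
      pochProd g (i.1 + i.2.1) * pochProd g' (i.2.1 + i.2.2) * pochProd g'' (i.2.2 + i.1) *
      pochProd h i.1 * pochProd h' i.2.1 * pochProd h'' i.2.2) *
    (x ^ i.1 / (i.1.factorial : ℂ)) * (y ^ i.2.1 / (i.2.1.factorial : ℂ)) *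
    (z ^ i.2.2 / (i.2.2.factorial : ℂ))

/-- Srivastava's general triple hypergeometric function `F⁽³⁾`. -/
def triple (a b b' b'' c c' c'' e g g' g'' h h' h'' : List ℂ) (x y z : ℂ) : ℂ :=
  ∑' i : ℕ × ℕ × ℕ, tripleTerm a b b' b'' c c' c'' e g g' g'' h h' h'' x y z i

/-- General term of the (Pochhammer-normalized) Srivastava–Daoust double series
`S[[a : θ, φ] : [b : ψ]; [b' : ψ'] / [c : δ, ε] : [d : η]; [d' : η'] | x, y]`
with natural-number weights. -/
def srivastavaTerm (a : List (ℂ × ℕ × ℕ)) (b b' : List (ℂ × ℕ))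
    (c : List (ℂ × ℕ × ℕ)) (d d' : List (ℂ × ℕ)) (x y : ℂ) (i : ℕ × ℕ) : ℂ :=
  pochProd₂ a i.1 i.2 * pochProd₁ b i.1 * pochProd₁ b' i.2 /
      (pochProd₂ c i.1 i.2 * pochProd₁ d i.1 * pochProd₁ d' i.2) *
    (x ^ i.1 / (i.1.factorial : ℂ)) * (y ^ i.2 / (i.2.factorial : ℂ))

/-- The Srivastava–Daoust `S`-function of two variables. -/
def srivastavaS (a : List (ℂ × ℕ × ℕ)) (b b' : List (ℂ × ℕ))
    (c : List (ℂ × ℕ × ℕ)) (d d' : List (ℂ × ℕ)) (x y : ℂ) : ℂ :=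
  ∑' i : ℕ × ℕ, srivastavaTerm a b b' c d d' x y i

end

/-! ### Pochhammer symbols and Vandermonde-type finite sums. -/

open Finset.HasAntidiagonal

/-! In every series of the theorem the parameters d and e enter only through the total degree N.
Each series is therefore the sum over N of `w N` times the coefficient of X^N in a product of formal
power series, where `w N` is (d)_N / (e)_N x^N or (d)_N x^N. So the theorem follows by linearity
from an identity in ℂ⟦X⟧, once absolute convergence is known.

The identity rests on an extension of Kummer's second theorem, `kummerSeries_eq_sum_besselSeries`:
₁F₁[a; 2a+m | X] is e^{X/2} times a finite combination of X^j ₀F₁[a+j+1/2 | X²/16]. It is proved for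
non-real a by induction on m through a contiguous relation, then for all admissible a by continuity.
Applied to α, and with X replaced by -X to β-n, it produces exponentials that cancel. Products of
two ₀F₁ are ₂F₃ by `besselSeries_mul`, which gives `kummerSeries_mul_rescale` and hence the case (x,
-x). Kummer's first theorem adds a factor e^X for the case (x, x), or e^{-X} as the first factor of
the triple series. A factor X^M shifts d and e by M, because (d)_{M+N} = (d)_M (d+M)_N.

For convergence, `w N` = O(δ^N N!), while the coefficients of each factor are O(c^N / N!) for every
c > 1. A double sum then converges when 2δ < 1 and a triple sum when 3δ < 1, whence the radii 1/2
and 1/3; with e present, δ may be arbitrarily small. -/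

lemma poch_zero (a : ℂ) : poch a 0 = 1 := by simp [poch]

lemma poch_succ (a : ℂ) (n : ℕ) : poch a (n + 1) = poch a n * (a + n) := by
  simp [poch, ascPochhammer_succ_eval]

lemma poch_one (a : ℂ) : poch a 1 = a := by simp [poch]

lemma poch_add (a : ℂ) (m n : ℕ) : poch a (m + n) = poch a m * poch (a + m) n := by
  induction n with
  | zero => simp [poch_zero]
  | succ n ih =>
    rw [← add_assoc, poch_succ, ih, poch_succ]
    push_cast
    ring

lemma poch_succ_left (a : ℂ) (n : ℕ) : poch a (n + 1) = a * poch (a + 1) n := by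
  rw [add_comm n 1, poch_add, poch_one]
  norm_num

lemma poch_one_left (n : ℕ) : poch 1 n = (n.factorial : ℂ) := by
  induction n with
  | zero => simp [poch_zero]
  | succ n ih =>
    rw [poch_succ, ih, Nat.factorial_succ]
    push_cast
    ring

lemma poch_ne_zero {a : ℂ} (h : ∀ l : ℕ, a ≠ -l) (n : ℕ) : poch a n ≠ 0 := by
  induction n with
  | zero => simp [poch_zero]
  | succ n ih =>
    rw [poch_succ]
    exact mul_ne_zero ih fun h0 => h n (eq_neg_of_add_eq_zero_left h0)

lemma poch_ne_zero_of_lt {a : ℂ} {m : ℕ} (h : ∀ l < m, a ≠ -l) {n : ℕ} (hn : n ≤ m) :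
    poch a n ≠ 0 := by
  induction n with
  | zero => simp [poch_zero]
  | succ n ih =>
    rw [poch_succ]
    exact mul_ne_zero (ih (by omega)) fun h0 => h n (by omega) (eq_neg_of_add_eq_zero_left h0)

lemma poch_ne_zero_of_im {a : ℂ} (h : a.im ≠ 0) (n : ℕ) : poch a n ≠ 0 :=
  poch_ne_zero (fun l hl => h (by simp [hl])) n

lemma poch_neg_natCast_eq_zero {m n : ℕ} (h : m < n) : poch (-m) n = 0 :=
  ascPochhammer_eval_neg_coe_nat_of_lt h

/-- Reverse the order of the factors and change the sign of each. -/
lemma poch_reflect (a : ℂ) (n : ℕ) : poch a n = (-1) ^ n * poch (1 - a - n) n := by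
  induction n generalizing a with
  | zero => simp [poch_zero]
  | succ n ih =>
    rw [poch_succ, ih, poch_succ_left]
    push_cast
    rw [show 1 - a - (n + 1) + 1 = 1 - a - n by ring]
    ring

/-- Separates the factors of even and odd index; this is the source of the parameter pairs c/2,
(c+1)/2. -/
lemma poch_two_mul (a : ℂ) (n : ℕ) :
    poch a (2 * n) = 4 ^ n * poch (a / 2) n * poch ((a + 1) / 2) n := by
  induction n with
  | zero => simp [poch_zero]
  | succ n ih =>
    rw [show 2 * (n + 1) = 2 * n + 1 + 1 by ring, poch_succ, poch_succ, ih, poch_succ, poch_succ]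
    push_cast
    ring

/-- The Chu–Vandermonde identity for Pochhammer symbols. -/
lemma sum_antidiagonal_choose_mul_poch (a b : ℂ) (n : ℕ) :
    ∑ i ∈ antidiagonal n, (n.choose i.1 : ℂ) * (poch a i.1 * poch b i.2) =
      poch (a + b) n := by
  induction n with
  | zero => simp [poch_zero]
  | succ n ih =>
    rw [Finset.sum_antidiagonal_choose_succ_mul (fun i j => poch a i * poch b j), poch_succ, ← ih,
      ← Finset.sum_add_distrib, Finset.sum_mul]
    refine Finset.sum_congr rfl fun i hi => ?_
    have hi' : (n : ℂ) = i.1 + i.2 := by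
      rw [← mem_antidiagonal.1 hi]
      push_cast
      rfl
    have hc : n.choose i.2 = n.choose i.1 := by
      rw [← mem_antidiagonal.1 hi]
      exact Nat.choose_symm_add.symm
    rw [poch_succ, poch_succ, hi', hc]
    ring

lemma choose_div_factorial {n : ℕ} {i : ℕ × ℕ} (hi : i ∈ antidiagonal n) :
    (n.choose i.1 : ℂ) / n.factorial = 1 / (i.1.factorial * i.2.factorial) := by
  obtain rfl := mem_antidiagonal.1 hi
  have h := Nat.add_choose_mul_factorial_mul_factorial i.1 i.2
  rw [← Nat.choose_symm_add] at h
  have h1 : ((i.1 + i.2).factorial : ℂ) ≠ 0 := by exact_mod_cast Nat.factorial_ne_zero _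
  have h2 : (i.1.factorial : ℂ) ≠ 0 := by exact_mod_cast Nat.factorial_ne_zero _
  have h3 : (i.2.factorial : ℂ) ≠ 0 := by exact_mod_cast Nat.factorial_ne_zero _
  rw [div_eq_div_iff h1 (mul_ne_zero h2 h3), ← h]
  push_cast
  ring

/-- Split (a)_n at the first index and reflect the tail. This moves a Pochhammer symbol from
denominator to numerator, so that Chu–Vandermonde applies. -/
lemma poch_div_poch_left (a : ℂ) {i : ℕ × ℕ} {n : ℕ} (hi : i ∈ antidiagonal n)
    (ha : ∀ l : ℕ, a ≠ -l) : 1 / poch a i.1 = (-1) ^ i.2 * poch (1 - a - n) i.2 / poch a n := by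
  obtain rfl := mem_antidiagonal.1 hi
  have h1 := poch_ne_zero ha i.1
  have h2 := poch_ne_zero ha (i.1 + i.2)
  rw [div_eq_div_iff h1 h2, poch_add, poch_reflect (a + i.1)]
  push_cast
  rw [show 1 - (a + i.1) - i.2 = 1 - a - (i.1 + i.2) by ring]
  ring

/-- Kummer's first theorem at the level of coefficients: after `poch_div_poch_left` it is
Chu–Vandermonde with parameter sum 1-a-n, reflected back to (a)_n. -/
lemma sum_antidiagonal_kummer (a c : ℂ) (hc : ∀ l : ℕ, c ≠ -l) (n : ℕ) :
    ∑ i ∈ antidiagonal n, (-1) ^ i.1 * (poch (c - a) i.1 / poch c i.1 / i.1.factorial) *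
      (1 / i.2.factorial) = poch a n / poch c n / n.factorial := by
  have key : ∀ i ∈ antidiagonal n,
      (-1) ^ i.1 * (poch (c - a) i.1 / poch c i.1 / i.1.factorial) * (1 / i.2.factorial) =
      (-1) ^ n / poch c n / n.factorial *
        ((n.choose i.1 : ℂ) * (poch (c - a) i.1 * poch (1 - c - n) i.2)) := by
    intro i hi
    have h1 := choose_div_factorial hi
    have h2 := poch_div_poch_left c hi hc
    have h3 : ((-1 : ℂ)) ^ n = (-1) ^ i.1 * (-1) ^ i.2 := by
      rw [← pow_add, mem_antidiagonal.1 hi]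
    calc _ = (-1) ^ i.1 * poch (c - a) i.1 * (1 / poch c i.1) *
          (1 / (i.1.factorial * i.2.factorial)) := by ring
      _ = _ := by
        rw [← h1, h2, h3]
        ring
  rw [Finset.sum_congr rfl key, ← Finset.mul_sum, sum_antidiagonal_choose_mul_poch,
    poch_reflect a n]
  rw [show c - a + (1 - c - n) = 1 - a - n by ring]
  ring

/-- The coefficients of a product of two ₀F₁ series; both denominators are moved up before
Chu–Vandermonde. -/
lemma sum_antidiagonal_bessel (a b : ℂ) (ha : ∀ l : ℕ, a ≠ -l) (hb : ∀ l : ℕ, b ≠ -l) (n : ℕ) :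
    ∑ i ∈ antidiagonal n, 1 / (poch a i.1 * i.1.factorial) *
      (1 / (poch b i.2 * i.2.factorial)) =
        poch (a + b - 1 + n) n / (poch a n * poch b n * n.factorial) := by
  have key : ∀ i ∈ antidiagonal n,
      1 / (poch a i.1 * i.1.factorial) * (1 / (poch b i.2 * i.2.factorial)) =
      (-1) ^ n / (poch a n * poch b n * n.factorial) *
        ((n.choose i.1 : ℂ) * (poch (1 - b - n) i.1 * poch (1 - a - n) i.2)) := by
    intro i hi
    have h1 := choose_div_factorial hi
    have h2 := poch_div_poch_left a hi ha
    have h4 := poch_div_poch_left b (swap_mem_antidiagonal.2 hi) hb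
    simp only [Prod.fst_swap, Prod.snd_swap] at h4
    have h3 : ((-1 : ℂ)) ^ n = (-1) ^ i.1 * (-1) ^ i.2 := by
      rw [← pow_add, mem_antidiagonal.1 hi]
    calc _ = (1 / poch a i.1) * (1 / poch b i.2) * (1 / (i.1.factorial * i.2.factorial)) := by
          ring
      _ = _ := by
        rw [← h1, h2, h4, h3]
        ring
  rw [Finset.sum_congr rfl key, ← Finset.mul_sum, sum_antidiagonal_choose_mul_poch,
    poch_reflect (a + b - 1 + n) n]
  rw [show 1 - b - n + (1 - a - n) = 1 - (a + b - 1 + n) - n by ring]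
  ring

/-! ### Formal power series and Kummer's two theorems. -/

noncomputable section

open PowerSeries in
/-- The formal exponential `e^{tX}`. -/
def expSeries (t : ℂ) : PowerSeries ℂ := rescale t (exp ℂ)

/-- The formal series of `₁F₁[a; c | X]`. -/
def kummerSeries (a c : ℂ) : PowerSeries ℂ :=
  PowerSeries.mk fun n => poch a n / poch c n / n.factorial

/-- The formal series of `₀F₁[-; b | X ^ 2 / 16]`. -/
def besselSeries (b : ℂ) : PowerSeries ℂ :=
  PowerSeries.expand 2 two_ne_zero
    (PowerSeries.mk fun s => 1 / (poch b s * s.factorial) * (1 / 16) ^ s)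

/-- The general coefficient of `₂F₃[c/2, (c+1)/2; a, b, c | z / 4]`. -/
def besselProdCoeff (a b c : ℂ) (s : ℕ) : ℂ :=
  poch (c / 2) s * poch ((c + 1) / 2) s / (poch a s * poch b s * poch c s) *
    ((1 / 4) ^ s / s.factorial)

/-- The formal series of `₂F₃[c/2, (c+1)/2; a, b, c | X ^ 2 / 4]`. -/
def besselProdSeries (a b c : ℂ) : PowerSeries ℂ :=
  PowerSeries.expand 2 two_ne_zero (PowerSeries.mk (besselProdCoeff a b c))

/-- The coefficients in the expansion of `e^{-X/2} ₁F₁[a; 2a+m | X]` in Bessel series. -/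
def kummerCoeff (a : ℂ) (m j : ℕ) : ℂ :=
  poch (-m) j * poch (2 * a - 1) j /
    (poch (2 * a + m) j * poch (a - 1 / 2) j * 4 ^ j * j.factorial)

end

open PowerSeries

lemma coeff_expSeries (t : ℂ) (n : ℕ) : coeff n (expSeries t) = t ^ n * (1 / n.factorial) := by
  simp [expSeries, coeff_exp, coeff_rescale]

lemma expSeries_mul (s t : ℂ) : expSeries s * expSeries t = expSeries (s + t) :=
  exp_mul_exp_eq_exp_add s t

lemma expSeries_zero : expSeries 0 = 1 := by
  ext n
  rw [coeff_expSeries, coeff_one]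
  rcases n with _ | n <;> simp

lemma derivative_expSeries (t : ℂ) : d⁄dX ℂ (expSeries t) = C t * expSeries t := by
  ext n
  rw [coeff_derivative, coeff_C_mul, coeff_expSeries, coeff_expSeries, Nat.factorial_succ]
  have : (n.factorial : ℂ) ≠ 0 := by exact_mod_cast n.factorial_ne_zero
  have : (n + 1 : ℂ) ≠ 0 := by exact_mod_cast n.succ_ne_zero
  push_cast
  field_simp
  ring

lemma coeff_kummerSeries (a c : ℂ) (n : ℕ) :
    coeff n (kummerSeries a c) = poch a n / poch c n / n.factorial := by
  simp [kummerSeries]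

/-- Kummer's first theorem. -/
lemma kummerSeries_eq_exp_mul (a c : ℂ) (hc : ∀ l : ℕ, c ≠ -l) :
    kummerSeries a c = expSeries 1 * rescale (-1) (kummerSeries (c - a) c) := by
  ext n
  rw [mul_comm, coeff_mul, coeff_kummerSeries, ← sum_antidiagonal_kummer a c hc]
  refine Finset.sum_congr rfl fun i _ => ?_
  rw [coeff_rescale, coeff_kummerSeries, coeff_expSeries, one_pow, one_mul]

/-- With c = a+b-1, the factor (c+n)_n equals (c)_{2n} / (c)_n, and duplication of (c)_{2n} yields
the two half-parameters. -/
lemma besselSeries_mul {a b : ℂ} (ha : ∀ l : ℕ, a ≠ -l) (hb : ∀ l : ℕ, b ≠ -l)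
    (hab : ∀ l : ℕ, a + b - 1 ≠ -l) :
    besselSeries a * besselSeries b = besselProdSeries a b (a + b - 1) := by
  rw [besselSeries, besselSeries, besselProdSeries, ← map_mul]
  congr 1
  ext n
  rw [coeff_mul]
  have key : ∀ i ∈ antidiagonal n,
      coeff i.1 (PowerSeries.mk fun s => 1 / (poch a s * s.factorial) * (1 / 16) ^ s) *
        coeff i.2 (PowerSeries.mk fun s => 1 / (poch b s * s.factorial) * (1 / 16) ^ s) =
      (1 / (poch a i.1 * i.1.factorial) * (1 / (poch b i.2 * i.2.factorial))) * (1 / 16) ^ n := by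
    intro i hi
    rw [← mem_antidiagonal.1 hi, coeff_mk, coeff_mk, pow_add]
    ring
  rw [Finset.sum_congr rfl key, ← Finset.sum_mul, sum_antidiagonal_bessel a b ha hb, coeff_mk,
    besselProdCoeff]
  have h1 := poch_ne_zero hab n
  have h2 := poch_two_mul (a + b - 1) n
  rw [two_mul, poch_add] at h2
  have h3 : poch (a + b - 1 + n) n =
      4 ^ n * poch ((a + b - 1) / 2) n * poch ((a + b - 1 + 1) / 2) n / poch (a + b - 1) n := by
    rw [eq_div_iff h1, ← h2]
    ring
  -- The 4^n from duplication turns the scale 1/16 into 1/4.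
  rw [h3, show (1 / 16 : ℂ) = (1 / 4) * (1 / 4) by norm_num, mul_pow, one_div_pow]
  field_simp

lemma coeff_besselSeries_recurrence (a : ℂ) (ha : ∀ l : ℕ, a + 1 / 2 ≠ -l) (n : ℕ) :
    (n + 2) * (n + 1 + 2 * a) * coeff (n + 2) (besselSeries (a + 1 / 2)) =
      coeff n (besselSeries (a + 1 / 2)) / 4 := by
  rw [besselSeries, coeff_expand, coeff_expand]
  by_cases h : 2 ∣ n
  · obtain ⟨s, rfl⟩ := h
    rw [if_pos (by omega), if_pos (by omega), show (2 * s + 2) / 2 = s + 1 by omega,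
      show 2 * s / 2 = s by omega, coeff_mk, coeff_mk, poch_succ, Nat.factorial_succ]
    have h1 := poch_ne_zero ha s
    have h2 : a + 1 / 2 + s ≠ 0 := fun h0 => ha s (eq_neg_of_add_eq_zero_left h0)
    have h3 : (s.factorial : ℂ) ≠ 0 := by exact_mod_cast s.factorial_ne_zero
    have h4 : (s + 1 : ℂ) ≠ 0 := by exact_mod_cast s.succ_ne_zero
    have h5 : (2 * s + 1 + 2 * a : ℂ) = 2 * (a + 1 / 2 + s) := by ring
    push_cast
    rw [h5]
    generalize a + 1 / 2 + (s : ℂ) = w at *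
    field_simp
    ring
  · rw [if_neg (by omega), if_neg h]
    ring

/-- The differential equation of ₀F₁[a+1/2 | X²/16], equivalent to the two-step coefficient
recurrence; it feeds the proof of Kummer's second theorem. -/
lemma bessel_ode (a : ℂ) (ha : ∀ l : ℕ, a + 1 / 2 ≠ -l) :
    X * d⁄dX ℂ (d⁄dX ℂ (besselSeries (a + 1 / 2))) + C (2 * a) * d⁄dX ℂ (besselSeries (a + 1 / 2)) -
      C (1 / 4) * (X * besselSeries (a + 1 / 2)) = 0 := by
  ext n
  rw [map_sub, map_add, coeff_C_mul, coeff_C_mul, coeff_derivative]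
  rcases n with _ | n
  · simp [besselSeries, coeff_expand]
  · rw [coeff_succ_X_mul, coeff_succ_X_mul, coeff_derivative, coeff_derivative]
    have := coeff_besselSeries_recurrence a ha n
    push_cast
    simp only [map_zero]
    linear_combination this

/-- Kummer's second theorem. -/
lemma kummerSeries_two_mul (a : ℂ) (ha : a.im ≠ 0) :
    kummerSeries a (2 * a) = expSeries (1 / 2) * besselSeries (a + 1 / 2) := by
  have ha' : ∀ l : ℕ, a + 1 / 2 ≠ -l := fun l hl => ha (by simpa using congrArg Complex.im hl)
  have h2a : ∀ l : ℕ, 2 * a ≠ -l := fun l hl => ha (by simpa using congrArg Complex.im hl)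
  set f := expSeries (1 / 2) * besselSeries (a + 1 / 2) with hf
  -- The product satisfies Kummer's confluent equation with parameters a and 2a, which is then read
  -- as a first-order recurrence for its coefficients.
  have hode : X * d⁄dX ℂ (d⁄dX ℂ f) + (C (2 * a) - X) * d⁄dX ℂ f - C a * f = 0 := by
    have h1 : d⁄dX ℂ f = expSeries (1 / 2) *
        (C (1 / 2) * besselSeries (a + 1 / 2) + d⁄dX ℂ (besselSeries (a + 1 / 2))) := by
      rw [hf, Derivation.leibniz, derivative_expSeries, smul_eq_mul, smul_eq_mul]
      ring
    have h2 : d⁄dX ℂ (d⁄dX ℂ f) = expSeries (1 / 2) *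
        (C (1 / 4) * besselSeries (a + 1 / 2) + d⁄dX ℂ (besselSeries (a + 1 / 2)) +
          d⁄dX ℂ (d⁄dX ℂ (besselSeries (a + 1 / 2)))) := by
      rw [h1, Derivation.leibniz, derivative_expSeries, map_add, Derivation.leibniz,
        derivative_C, smul_eq_mul, smul_eq_mul, smul_eq_mul, smul_eq_mul,
        show (1 / 4 : ℂ) = 1 / 2 * (1 / 2) by norm_num, map_mul]
      have : (C (1 / 2 : ℂ) + C (1 / 2 : ℂ) : ℂ⟦X⟧) = 1 := by
        rw [← map_add, ← map_one C]
        norm_num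
      linear_combination expSeries (1 / 2) * d⁄dX ℂ (besselSeries (a + 1 / 2)) * this
    have h3 := bessel_ode a ha'
    -- Constants wrapped in `C` are atoms for `ring`, so their numerical relations are supplied by
    -- hand.
    have h4 : (C (1 / 2 : ℂ) : ℂ⟦X⟧) = 2 * C (1 / 4 : ℂ) := by
      rw [two_mul, ← map_add]
      norm_num
    have h5 : (4 * C (1 / 4 : ℂ) : ℂ⟦X⟧) = 1 := by
      rw [← map_ofNat (C (R := ℂ)) 4, ← map_mul, ← map_one C]
      norm_num
    have h6 : (C (2 * a) : ℂ⟦X⟧) = 2 * C a := by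
      rw [map_mul, map_ofNat]
    rw [h2, h1, hf, h4, h6]
    rw [h6] at h3
    linear_combination expSeries (1 / 2) * h3 +
      expSeries (1 / 2) * C a * besselSeries (a + 1 / 2) * h5
  have hrec : ∀ n : ℕ, (n + 1) * (n + 2 * a) * coeff (n + 1) f = (n + a) * coeff n f := by
    intro n
    have h := congrArg (coeff n) hode
    rw [map_sub, map_add, sub_mul, map_sub, coeff_C_mul, coeff_C_mul, coeff_derivative] at h
    rcases n with _ | n
    · simp only [coeff_zero_X_mul, map_zero] at h
      push_cast at h ⊢
      linear_combination h
    · rw [coeff_succ_X_mul, coeff_succ_X_mul, coeff_derivative, coeff_derivative,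
        coeff_derivative] at h
      simp only [map_zero] at h
      push_cast at h ⊢
      linear_combination h
  have h0 : coeff 0 f = 1 := by
    simp [hf, coeff_mul, coeff_expSeries, besselSeries, poch_zero]
  ext n
  rw [coeff_kummerSeries]
  induction n with
  | zero => simp [h0, poch_zero]
  -- The recurrence can be solved for the next coefficient because n + 2a never vanishes.
  | succ n ih =>
    have h1 : (n + 1 : ℂ) ≠ 0 := by exact_mod_cast n.succ_ne_zero
    have h2 : (n + 2 * a : ℂ) ≠ 0 := fun h0 => h2a n (eq_neg_of_add_eq_zero_right h0)
    have h3 : coeff (n + 1) f = (n + a) * coeff n f / ((n + 1) * (n + 2 * a)) := by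
      rw [eq_div_iff (mul_ne_zero h1 h2), ← hrec]
      ring
    rw [h3, ← ih, poch_succ, poch_succ, Nat.factorial_succ]
    push_cast
    rw [add_comm a, add_comm (2 * a)]
    generalize (n : ℂ) + a = u
    generalize (n : ℂ) + 2 * a = v
    generalize (n : ℂ) + 1 = w
    ring

/-! ### Extension to ₁F₁[a; 2a+m] by contiguity and continuity. -/

/-- Holds since 1/(c)_n - 1/(c+1)_n = n / (c (c+1)_n). For c = 2a+m both series on the right are at
level m, as c+2 = 2(a+1)+m; this drives the induction. -/
lemma kummerSeries_contiguous (a c : ℂ) (hc : ∀ l : ℕ, c ≠ -l) :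
    kummerSeries a (c + 1) =
      kummerSeries a c - C (a / (c * (c + 1))) * (X * kummerSeries (a + 1) (c + 2)) := by
  ext n
  rw [map_sub, coeff_C_mul, coeff_kummerSeries, coeff_kummerSeries]
  rcases n with _ | n
  · simp [poch_zero]
  · have h1 : c ≠ 0 := by simpa using hc 0
    have h2 : c + 1 ≠ 0 := fun h => hc 1 (by rw [eq_neg_of_add_eq_zero_left h]; simp)
    have h3 : (n + 1 : ℂ) ≠ 0 := by exact_mod_cast n.succ_ne_zero
    have h4 : (n.factorial : ℂ) ≠ 0 := by exact_mod_cast n.factorial_ne_zero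
    have hp := poch_ne_zero hc (n + 2)
    rw [coeff_succ_X_mul, coeff_kummerSeries, poch_succ_left a, poch_succ_left c,
      Nat.factorial_succ]
    rw [poch_succ_left c, poch_succ_left] at hp
    have h5 := poch_succ (c + 1) n
    rw [poch_succ_left] at h5
    rw [show c + 1 + 1 = c + 2 by ring] at h5 hp
    have h6 : poch (c + 2) n ≠ 0 := by
      intro h
      simp [h] at hp
    have h7 : c + 1 + n ≠ 0 := by
      intro h
      rw [h, mul_zero] at h5
      exact mul_ne_zero h2 h6 h5
    have h8 : poch (c + 1) n = (c + 1) * poch (c + 2) n / (c + 1 + n) := by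
      rw [eq_div_iff h7, h5]
    rw [poch_succ (c + 1), h8]
    push_cast
    field_simp
    ring

lemma kummerCoeff_zero (a : ℂ) (m : ℕ) : kummerCoeff a m 0 = 1 := by
  simp [kummerCoeff, poch_zero]

lemma kummerCoeff_eq_zero (a : ℂ) {m j : ℕ} (h : m < j) : kummerCoeff a m j = 0 := by
  simp [kummerCoeff, poch_neg_natCast_eq_zero h]

/-- The contiguous relation seen on the expansion coefficients. For non-real a no linear factor ra+s
with real r ≠ 0 and s can vanish, so all denominators may be cleared. -/
lemma kummerCoeff_succ (a : ℂ) (ha : a.im ≠ 0) (m j : ℕ) :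
    kummerCoeff a (m + 1) (j + 1) = kummerCoeff a m (j + 1) -
      a / ((2 * a + m) * (2 * a + m + 1)) * kummerCoeff (a + 1) m j := by
  have him : ∀ r s : ℝ, r ≠ 0 → (r * a + s : ℂ) ≠ 0 := fun r s hr h =>
    mul_ne_zero hr ha (by simpa using congrArg Complex.im h)
  have h1 : (2 * a + m : ℂ) ≠ 0 := by simpa using him 2 m two_ne_zero
  have h2 : (2 * a + m + 1 : ℂ) ≠ 0 := by simpa [add_assoc] using him 2 (m + 1) two_ne_zero
  have h3 : (2 * a + m + 1 + j : ℂ) ≠ 0 := by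
    simpa [add_assoc] using him 2 (m + (1 + j)) two_ne_zero
  have h4 : (j + 1 : ℂ) ≠ 0 := by exact_mod_cast j.succ_ne_zero
  have h5 : (j.factorial : ℂ) ≠ 0 := by exact_mod_cast j.factorial_ne_zero
  have h6 : (a - 1 / 2 : ℂ) ≠ 0 := by simpa [sub_eq_add_neg] using him 1 (-(1 / 2)) one_ne_zero
  have h7 : a ≠ 0 := by simpa using him 1 0 one_ne_zero
  have h8 : poch (a + 1 / 2) j ≠ 0 := poch_ne_zero_of_im (by simpa using ha) j
  have h9 : poch (2 * a + m + 1) j ≠ 0 := poch_ne_zero_of_im (by simpa using ha) j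
  have e1 : poch (2 * a + 1) j = poch (2 * a) j * (2 * a + j) / (2 * a) := by
    rw [eq_div_iff (by simpa using h7), ← poch_succ, poch_succ_left]
    ring
  have e2 : poch (2 * a + m + 2) j =
      poch (2 * a + m + 1) j * (2 * a + m + 1 + j) / (2 * a + m + 1) := by
    rw [eq_div_iff h2, ← poch_succ, poch_succ_left,
      show (2 * a + m + 2 : ℂ) = 2 * a + m + 1 + 1 by ring]
    ring
  rw [kummerCoeff, kummerCoeff, kummerCoeff, poch_succ_left (2 * a - 1), poch_succ_left (a - 1 / 2),
    poch_succ (2 * a + (m + 1 : ℕ)), poch_succ_left (2 * a + m), poch_succ (-m),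
    poch_succ_left (-((m + 1 : ℕ) : ℂ)), Nat.factorial_succ]
  push_cast
  rw [show -(m + 1 : ℂ) + 1 = -m by ring, show 2 * a - 1 + 1 = 2 * a by ring,
    show a - 1 / 2 + 1 = a + 1 / 2 by ring, show 2 * (a + 1) - 1 = 2 * a + 1 by ring,
    show a + 1 - 1 / 2 = a + 1 / 2 by ring, show 2 * (a + 1) + m = 2 * a + m + 2 by ring,
    ← add_assoc, e1, e2, show 2 * a - 1 = 2 * (a - 1 / 2) by ring, pow_succ]
  generalize poch (a + 1 / 2) j = A at *
  generalize a - 1 / 2 = B at *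
  generalize poch (2 * a + m + 1) j = D at *
  clear e1 e2 him
  generalize (m : ℂ) = μ at *
  -- Taking 2a+m as the free variable in place of m makes the denominators simpler for `field_simp`.
  obtain ⟨c, hc⟩ : ∃ c, c = 2 * a + μ := ⟨_, rfl⟩
  obtain rfl : μ = c - 2 * a := by rw [hc]; ring
  rw [add_sub_cancel] at h1 h2 h3 ⊢
  field_simp
  ring

/-- The induction passes from (a, m) and (a+1, m) to (a, m+1), so a must vary. Admissibility at
level m+1 does not imply it at level m; non-real a avoids the problem. -/
lemma kummerSeries_eq_of_im_ne_zero (m : ℕ) : ∀ a : ℂ, a.im ≠ 0 →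
    kummerSeries a (2 * a + m) = expSeries (1 / 2) * ∑ j ∈ Finset.range (m + 1),
      C (kummerCoeff a m j) * (X ^ j * besselSeries (a + j + 1 / 2)) := by
  induction m with
  | zero =>
    intro a ha
    simp [kummerSeries_two_mul a ha, kummerCoeff_zero]
  | succ m ih =>
    intro a ha
    have hc : ∀ l : ℕ, 2 * a + m ≠ -l := fun l hl => ha (by simpa using congrArg Complex.im hl)
    have ha1 : (a + 1).im ≠ 0 := by simpa using ha
    have h2 := ih (a + 1) ha1
    rw [show 2 * (a + 1) + m = 2 * a + m + 2 by ring] at h2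
    push_cast
    rw [← add_assoc, kummerSeries_contiguous _ _ hc, ih a ha, h2]
    -- The added term j = m+1 is zero, since (-m)_{m+1} = 0; both sums now have the same range.
    have h3 : ∑ j ∈ Finset.range (m + 1),
        C (kummerCoeff a m j) * (X ^ j * besselSeries (a + j + 1 / 2)) =
      ∑ j ∈ Finset.range (m + 2),
        C (kummerCoeff a m j) * (X ^ j * besselSeries (a + j + 1 / 2)) := by
      rw [Finset.sum_range_succ _ (m + 1), kummerCoeff_eq_zero a (Nat.lt_succ_self m)]
      simp
    have h4 : ∀ j : ℕ, besselSeries (a + 1 + j + 1 / 2) =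
        besselSeries (a + (j + 1 : ℕ) + 1 / 2) := by
      intro j
      push_cast
      congr 1
      ring
    have h5 : ∑ j ∈ Finset.range (m + 2),
        C (kummerCoeff a (m + 1) j) * (X ^ j * besselSeries (a + j + 1 / 2)) =
      ∑ j ∈ Finset.range (m + 2),
        C (kummerCoeff a m j) * (X ^ j * besselSeries (a + j + 1 / 2)) -
      C (a / ((2 * a + m) * (2 * a + m + 1))) * (X * ∑ j ∈ Finset.range (m + 1),
        C (kummerCoeff (a + 1) m j) * (X ^ j * besselSeries (a + 1 + j + 1 / 2))) := by
      rw [Finset.sum_range_succ' _ (m + 1), Finset.sum_range_succ' _ (m + 1), Finset.mul_sum,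
        Finset.mul_sum, kummerCoeff_zero, kummerCoeff_zero, add_sub_right_comm,
        ← Finset.sum_sub_distrib]
      congr 1
      refine Finset.sum_congr rfl fun j _ => ?_
      rw [kummerCoeff_succ a ha, h4, map_sub, map_mul]
      ring
    rw [h3, h5]
    ring

lemma continuous_poch (n : ℕ) : Continuous fun a => poch a n :=
  (ascPochhammer ℂ n).continuous

/-- The expansion of `₁F₁[a; 2a+m | X]` in Bessel series, generalizing Kummer's second theorem. -/
lemma kummerSeries_eq_sum_besselSeries (a : ℂ) (m : ℕ) (h2a : ∀ l : ℕ, 2 * a + m ≠ -l)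
    (ha : ∀ l < m, a - 1 / 2 ≠ -l) (ha' : ∀ l : ℕ, a + 1 / 2 ≠ -l) :
    kummerSeries a (2 * a + m) = expSeries (1 / 2) * ∑ j ∈ Finset.range (m + 1),
      C (kummerCoeff a m j) * (X ^ j * besselSeries (a + j + 1 / 2)) := by
  by_cases him : a.im = 0
  swap
  · exact kummerSeries_eq_of_im_ne_zero m a him
  -- A real a is approached by non-real points; coefficient by coefficient both sides are continuous
  -- at a, because the hypotheses keep every denominator nonzero there.
  let z : ℕ → ℂ := fun k => a + ((1 / ((k : ℝ) + 1) : ℝ) : ℂ) * Complex.I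
  have hz : Filter.Tendsto z Filter.atTop (nhds a) := by
    have h := (Complex.continuous_ofReal.tendsto 0).comp
      tendsto_one_div_add_atTop_nhds_zero_nat
    simpa [z, Function.comp_def] using! (h.mul_const Complex.I).const_add a
  have hzim : ∀ k, (z k).im ≠ 0 := by
    intro k
    have : (z k).im = 1 / ((k : ℝ) + 1) := by
      simp only [z, Complex.add_im, him, Complex.im_ofReal_mul,
        Complex.I_im, mul_one, zero_add]
    rw [this]
    positivity
  have hp : ∀ (g : ℂ → ℂ) (j : ℕ), Continuous g → ContinuousAt (fun w => poch (g w) j) a :=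
    fun g j hg => ((continuous_poch j).comp hg).continuousAt
  ext n
  have hL : ContinuousAt (fun w : ℂ => coeff n (kummerSeries w (2 * w + m))) a := by
    simp only [coeff_kummerSeries]
    refine ContinuousAt.div_const ?_ _
    exact (hp _ n (by fun_prop)).div (hp _ n (by fun_prop)) (poch_ne_zero h2a n)
  have hR : ContinuousAt (fun w : ℂ => coeff n (expSeries (1 / 2) *
      ∑ j ∈ Finset.range (m + 1),
        C (kummerCoeff w m j) * (X ^ j * besselSeries (w + j + 1 / 2)))) a := by
    simp only [coeff_mul n, map_sum, coeff_C_mul]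
    refine tendsto_finsetSum _ fun i _ => ContinuousAt.mul continuousAt_const ?_
    refine tendsto_finsetSum _ fun j hj => ContinuousAt.mul ?_ ?_
    · have hjm : j ≤ m := Nat.lt_succ_iff.1 (Finset.mem_range.1 hj)
      unfold kummerCoeff
      refine ContinuousAt.div (continuousAt_const.mul (hp _ j (by fun_prop))) ?_ ?_
      · exact (((hp _ j (by fun_prop)).mul (hp _ j (by fun_prop))).mul continuousAt_const).mul
          continuousAt_const
      · exact mul_ne_zero (mul_ne_zero (mul_ne_zero (poch_ne_zero h2a j)
          (poch_ne_zero_of_lt ha hjm)) (by simp)) (by exact_mod_cast j.factorial_ne_zero)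
    · simp only [coeff_X_pow_mul', besselSeries, coeff_expand, coeff_mk]
      split_ifs
      · refine ContinuousAt.mul (ContinuousAt.div continuousAt_const
          ((hp _ _ (by fun_prop)).mul continuousAt_const) ?_) continuousAt_const
        refine mul_ne_zero (poch_ne_zero (fun l hl => ha' (j + l) ?_) _)
          (by exact_mod_cast Nat.factorial_ne_zero _)
        push_cast
        linear_combination hl
      · exact continuousAt_const
      · exact continuousAt_const
  refine tendsto_nhds_unique (hL.tendsto.comp hz) ((hR.tendsto.comp hz).congr fun k => ?_)
  simp only [Function.comp_apply]
  rw [kummerSeries_eq_of_im_ne_zero m (z k) (hzim k)]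

/-! ### The product of two Kummer series. -/

lemma rescale_C (t r : ℂ) : rescale t (C r : ℂ⟦X⟧) = C r := by
  ext n
  rw [coeff_rescale, coeff_C]
  split_ifs with h <;> simp [h]

lemma rescale_neg_one_besselSeries (b : ℂ) :
    rescale (-1) (besselSeries b) = besselSeries b := by
  ext n
  rw [coeff_rescale, besselSeries, coeff_expand]
  split_ifs with h
  · rw [(even_iff_two_dvd.2 h).neg_one_pow, one_mul]
  · rw [mul_zero]

lemma rescale_expSeries (s t : ℂ) : rescale s (expSeries t) = expSeries (t * s) := by
  rw [expSeries, expSeries, rescale_rescale]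

/-- The expansion with a = b-n and m = n, since 2(b-n)+n = 2b-n. Under X ↦ -X the Bessel series are
even and X^k contributes the sign (-1)^k. -/
lemma rescale_neg_one_kummerSeries (b : ℂ) (n : ℕ) (h2b : ∀ l : ℕ, 2 * b - n ≠ -l)
    (hb : ∀ l < n, b - n - 1 / 2 ≠ -l) (hb' : ∀ l : ℕ, b - n + 1 / 2 ≠ -l) :
    rescale (-1) (kummerSeries (b - n) (2 * b - n)) =
      expSeries (-(1 / 2)) * ∑ k ∈ Finset.range (n + 1),
        C ((-1) ^ k * kummerCoeff (b - n) n k) * (X ^ k * besselSeries (b + k - n + 1 / 2)) := by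
  have h := kummerSeries_eq_sum_besselSeries (b - n) n
    (fun l hl => h2b l (by rw [← hl]; ring)) hb hb'
  rw [show 2 * (b - n) + n = 2 * b - n by ring] at h
  rw [h, map_mul, rescale_expSeries, map_sum, mul_neg_one]
  congr 1
  refine Finset.sum_congr rfl fun k _ => ?_
  rw [map_mul, map_mul, rescale_C, rescale_neg_one_besselSeries, map_pow, rescale_X, map_mul,
    show b - n + k + 1 / 2 = b + k - n + 1 / 2 by ring, mul_pow, map_pow]
  ring

/-- The coefficients of the double expansion of a product of two Kummer series. -/
noncomputable def kummerProdCoeff (a b : ℂ) (m n j k : ℕ) : ℂ :=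
  kummerCoeff a m j * ((-1) ^ k * kummerCoeff (b - n) n k)

/-- The factors e^{X/2} and e^{-X/2} cancel, leaving a double sum of products of Bessel series. -/
lemma kummerSeries_mul_rescale (a b : ℂ) (m n : ℕ) (h2a : ∀ l : ℕ, 2 * a + m ≠ -l)
    (h2b : ∀ l : ℕ, 2 * b - n ≠ -l)
    (ha : ∀ l < m, a - 1 / 2 ≠ -l) (ha' : ∀ l : ℕ, a + 1 / 2 ≠ -l)
    (hb : ∀ l < n, b - n - 1 / 2 ≠ -l) (hb' : ∀ l : ℕ, b - n + 1 / 2 ≠ -l)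
    (hab : ∀ l : ℕ, a + b - n ≠ -l) :
    kummerSeries a (2 * a + m) * rescale (-1) (kummerSeries (b - n) (2 * b - n)) =
      ∑ j ∈ Finset.range (m + 1), ∑ k ∈ Finset.range (n + 1),
        C (kummerProdCoeff a b m n j k) * (X ^ (j + k) *
          besselProdSeries (a + j + 1 / 2) (b + k - n + 1 / 2) (a + b + j + k - n)) := by
  rw [kummerSeries_eq_sum_besselSeries a m h2a ha ha', rescale_neg_one_kummerSeries b n h2b hb hb',
    mul_mul_mul_comm, expSeries_mul, add_neg_cancel, expSeries_zero, one_mul, Finset.sum_mul_sum]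
  refine Finset.sum_congr rfl fun j _ => Finset.sum_congr rfl fun k _ => ?_
  have h := besselSeries_mul (a := a + j + 1 / 2) (b := b + k - n + 1 / 2)
    (fun l hl => ha' (j + l) (by push_cast; linear_combination hl))
    (fun l hl => hb' (k + l) (by push_cast; linear_combination hl))
    (fun l hl => hab (j + k + l) (by push_cast; linear_combination hl))
  rw [show a + j + 1 / 2 + (b + k - n + 1 / 2) - 1 = a + b + j + k - n by ring] at h
  rw [← h, kummerProdCoeff, map_mul, map_mul, map_mul, pow_add]
  ring

lemma kummerSeries_eq_exp_mul_rescale (b : ℂ) (n : ℕ) (h2b : ∀ l : ℕ, 2 * b - n ≠ -l) :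
    kummerSeries b (2 * b - n) =
      expSeries 1 * rescale (-1) (kummerSeries (b - n) (2 * b - n)) := by
  rw [kummerSeries_eq_exp_mul b _ h2b, show 2 * b - n - b = b - n by ring]

lemma expSeries_neg_one_mul_kummerSeries (b : ℂ) (n : ℕ) (h2b : ∀ l : ℕ, 2 * b - n ≠ -l) :
    expSeries (-1) * kummerSeries b (2 * b - n) =
      rescale (-1) (kummerSeries (b - n) (2 * b - n)) := by
  rw [kummerSeries_eq_exp_mul_rescale b n h2b, ← mul_assoc, expSeries_mul, neg_add_cancel,
    expSeries_zero, one_mul]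

/-! ### Growth classes and rearrangement of weighted multiple series. -/

/-- `w n = O(δ ^ n n!)`. -/
def FactorialBound (w : ℕ → ℂ) (δ : ℝ) : Prop :=
  ∃ K : ℝ, ∀ n, ‖w n‖ ≤ K * (δ ^ n * n.factorial)

/-- `u n = O(c ^ n / n!)`. -/
def ExpBound (u : ℕ → ℂ) (c : ℝ) : Prop :=
  ∃ K : ℝ, ∀ n, ‖u n‖ ≤ K * (c ^ n / n.factorial)

lemma sum_antidiagonal_pow_div_factorial (c d : ℝ) (n : ℕ) :
    ∑ i ∈ antidiagonal n, c ^ i.1 / i.1.factorial * (d ^ i.2 / i.2.factorial) =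
      (c + d) ^ n / n.factorial := by
  rw [(Commute.all c d).add_pow', Finset.sum_div]
  refine Finset.sum_congr rfl fun i hi => ?_
  obtain rfl := mem_antidiagonal.1 hi
  have h := Nat.add_choose_mul_factorial_mul_factorial i.1 i.2
  rw [← Nat.choose_symm_add] at h
  have h1 : ((i.1 + i.2).factorial : ℝ) ≠ 0 := by exact_mod_cast Nat.factorial_ne_zero _
  have h2 : (i.1.factorial : ℝ) ≠ 0 := by exact_mod_cast Nat.factorial_ne_zero _
  have h3 : (i.2.factorial : ℝ) ≠ 0 := by exact_mod_cast Nat.factorial_ne_zero _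
  rw [div_mul_div_comm, nsmul_eq_mul, div_eq_div_iff (mul_ne_zero h2 h3) h1, ← h]
  push_cast
  ring

/-- By the binomial theorem the antidiagonal of degree n sums to (δ(c+d))^n, a geometric series. -/
lemma summable_factorial_mul_pow {δ c d : ℝ} (hδ : 0 ≤ δ) (hc : 0 ≤ c) (hd : 0 ≤ d)
    (h : δ * (c + d) < 1) :
    Summable fun i : ℕ × ℕ => δ ^ (i.1 + i.2) * (i.1 + i.2).factorial *
      (c ^ i.1 / i.1.factorial * (d ^ i.2 / i.2.factorial)) := by
  rw [← Finset.HasAntidiagonal.sigmaAntidiagonalEquivProd.summable_iff,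
    summable_sigma_of_nonneg fun i => by simp only [Function.comp_apply]; positivity]
  refine ⟨fun n => (hasSum_fintype _).summable, ?_⟩
  refine (summable_geometric_of_lt_one (by positivity) h).congr fun n => ?_
  rw [tsum_fintype]
  simp only [Function.comp_apply, Finset.HasAntidiagonal.sigmaAntidiagonalEquivProd_apply]
  rw [Finset.sum_coe_sort (antidiagonal n) fun i => δ ^ (i.1 + i.2) * (i.1 + i.2).factorial *
      (c ^ i.1 / i.1.factorial * (d ^ i.2 / i.2.factorial))]
  rw [Finset.sum_congr rfl (g := fun i => δ ^ n * n.factorial *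
      (c ^ i.1 / i.1.factorial * (d ^ i.2 / i.2.factorial)))
      fun i hi => by rw [mem_antidiagonal.1 hi], ← Finset.mul_sum,
    sum_antidiagonal_pow_div_factorial, mul_pow]
  have : (n.factorial : ℝ) ≠ 0 := by exact_mod_cast Nat.factorial_ne_zero _
  field_simp

section

variable {w u v : ℕ → ℂ} {δ c d : ℝ}

lemma ExpBound.sum_norm_le (hu : ExpBound u c) (hv : ExpBound v d) :
    ∃ K : ℝ, ∀ n, ∑ i ∈ antidiagonal n, ‖u i.1 * v i.2‖ ≤ K * ((c + d) ^ n / n.factorial) := by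
  obtain ⟨K, hK⟩ := hu
  obtain ⟨L, hL⟩ := hv
  refine ⟨K * L, fun n => ?_⟩
  rw [← sum_antidiagonal_pow_div_factorial, Finset.mul_sum]
  refine Finset.sum_le_sum fun i _ => ?_
  rw [norm_mul]
  calc _ ≤ (K * (c ^ i.1 / i.1.factorial)) * (L * (d ^ i.2 / i.2.factorial)) :=
        mul_le_mul (hK _) (hL _) (norm_nonneg _) ((norm_nonneg _).trans (hK _))
    _ = _ := by ring

lemma summable_weighted_mul (hδ : 0 ≤ δ) (hc : 0 ≤ c) (hd : 0 ≤ d) (h : δ * (c + d) < 1)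
    (hw : FactorialBound w δ) (hu : ExpBound u c) (hv : ExpBound v d) :
    Summable fun i : ℕ × ℕ => w (i.1 + i.2) * (u i.1 * v i.2) := by
  obtain ⟨J, hJ⟩ := hw
  obtain ⟨K, hK⟩ := hu
  obtain ⟨L, hL⟩ := hv
  refine Summable.of_norm_bounded ((summable_factorial_mul_pow hδ hc hd h).mul_left (J * (K * L)))
    fun i => ?_
  rw [norm_mul, norm_mul]
  calc _ ≤ (J * (δ ^ (i.1 + i.2) * (i.1 + i.2).factorial)) *
        ((K * (c ^ i.1 / i.1.factorial)) * (L * (d ^ i.2 / i.2.factorial))) := by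
        refine mul_le_mul (hJ _) ?_ (by positivity) ((norm_nonneg _).trans (hJ _))
        exact mul_le_mul (hK _) (hL _) (norm_nonneg _) ((norm_nonneg _).trans (hK _))
    _ = _ := by ring

lemma hasSum_weighted_antidiagonal
    (h : Summable fun i : ℕ × ℕ => w (i.1 + i.2) * (u i.1 * v i.2)) :
    HasSum (fun n => w n * ∑ i ∈ antidiagonal n, u i.1 * v i.2)
      (∑' i : ℕ × ℕ, w (i.1 + i.2) * (u i.1 * v i.2)) := by
  have h1 := (Finset.HasAntidiagonal.sigmaAntidiagonalEquivProd.hasSum_iff.2 h.hasSum).sigma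
    fun n => hasSum_fintype _
  refine h1.congr_fun fun n => ?_
  simp only [Function.comp_apply, Finset.HasAntidiagonal.sigmaAntidiagonalEquivProd_apply]
  rw [Finset.sum_coe_sort (antidiagonal n) fun i => w (i.1 + i.2) * (u i.1 * v i.2),
    Finset.mul_sum]
  exact Finset.sum_congr rfl fun i hi => by rw [mem_antidiagonal.1 hi]

end

/-- Triples of natural numbers, sorted by the first entry and the sum of the other two. -/
def sigmaAntidiagonalSndEquiv :
    (Σ i : ℕ × ℕ, antidiagonal i.2) ≃ ℕ × ℕ × ℕ where
  toFun x := (x.1.1, x.2.1)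
  invFun t := ⟨(t.1, t.2.1 + t.2.2), ⟨t.2, by simp⟩⟩
  left_inv := by
    rintro ⟨⟨r, s⟩, ⟨p, q⟩, h⟩
    obtain rfl := mem_antidiagonal.1 h
    rfl
  right_inv _ := rfl

/-- Convolving the last two factors in norm gives growth rate c+d, which reduces the triple sum to a
double one. -/
lemma summable_weighted_triple {w t u v : ℕ → ℂ} {δ b c d : ℝ} (hδ : 0 ≤ δ) (hb : 0 ≤ b)
    (hc : 0 ≤ c) (hd : 0 ≤ d) (h : δ * (b + (c + d)) < 1) (hw : FactorialBound w δ)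
    (ht : ExpBound t b) (hu : ExpBound u c) (hv : ExpBound v d) :
    Summable fun i : ℕ × ℕ × ℕ => w (i.1 + (i.2.1 + i.2.2)) * (t i.1 * (u i.2.1 * v i.2.2)) := by
  obtain ⟨J, hJ⟩ := hw
  obtain ⟨L, hL⟩ := ht
  obtain ⟨K, hK⟩ := hu.sum_norm_le hv
  rw [← summable_norm_iff, ← sigmaAntidiagonalSndEquiv.summable_iff,
    summable_sigma_of_nonneg fun i => by simp only [Function.comp_apply]; positivity]
  refine ⟨fun n => (hasSum_fintype _).summable, ?_⟩
  refine Summable.of_nonneg_of_le (fun i => tsum_nonneg fun _ => norm_nonneg _) (fun i => ?_)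
    ((summable_factorial_mul_pow hδ hb (add_nonneg hc hd) h).mul_left (J * (L * K)))
  rw [tsum_fintype]
  simp only [Function.comp_apply, sigmaAntidiagonalSndEquiv, Equiv.coe_fn_mk]
  rw [Finset.sum_coe_sort (antidiagonal i.2) fun p =>
    ‖w (i.1 + (p.1 + p.2)) * (t i.1 * (u p.1 * v p.2))‖]
  rw [Finset.sum_congr rfl (g := fun p => ‖w (i.1 + i.2)‖ * ‖t i.1‖ * ‖u p.1 * v p.2‖)
      fun p hp => by rw [mem_antidiagonal.1 hp, norm_mul, norm_mul (t i.1), mul_assoc],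
    ← Finset.mul_sum]
  calc _ ≤ (J * (δ ^ (i.1 + i.2) * (i.1 + i.2).factorial)) * (L * (b ^ i.1 / i.1.factorial)) *
        (K * ((c + d) ^ i.2 / i.2.factorial)) := by
        refine mul_le_mul ?_ (hK _) (Finset.sum_nonneg fun _ _ => norm_nonneg _) ?_
        · exact mul_le_mul (hJ _) (hL _) (norm_nonneg _) ((norm_nonneg _).trans (hJ _))
        · exact mul_nonneg ((norm_nonneg _).trans (hJ _)) ((norm_nonneg _).trans (hL _))
    _ = _ := by ring

lemma hasSum_weighted_triple {w t u v : ℕ → ℂ}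
    (h : Summable fun i : ℕ × ℕ × ℕ =>
      w (i.1 + (i.2.1 + i.2.2)) * (t i.1 * (u i.2.1 * v i.2.2))) :
    HasSum (fun n => w n * ∑ i ∈ antidiagonal n,
      t i.1 * ∑ p ∈ antidiagonal i.2, u p.1 * v p.2)
      (∑' i : ℕ × ℕ × ℕ, w (i.1 + (i.2.1 + i.2.2)) * (t i.1 * (u i.2.1 * v i.2.2))) := by
  have h1 := (sigmaAntidiagonalSndEquiv.hasSum_iff.2 h.hasSum).sigma fun n => hasSum_fintype _
  have h2 : HasSum (fun i : ℕ × ℕ =>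
      w (i.1 + i.2) * (t i.1 * ∑ p ∈ antidiagonal i.2, u p.1 * v p.2))
      (∑' i : ℕ × ℕ × ℕ, w (i.1 + (i.2.1 + i.2.2)) * (t i.1 * (u i.2.1 * v i.2.2))) := by
    refine h1.congr_fun fun i => ?_
    simp only [Function.comp_apply, sigmaAntidiagonalSndEquiv, Equiv.coe_fn_mk]
    rw [Finset.sum_coe_sort (antidiagonal i.2) fun p =>
      w (i.1 + (p.1 + p.2)) * (t i.1 * (u p.1 * v p.2)), Finset.mul_sum, Finset.mul_sum]
    exact Finset.sum_congr rfl fun p hp => by rw [mem_antidiagonal.1 hp]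
  rw [← h2.tsum_eq]
  exact hasSum_weighted_antidiagonal (v := fun n => ∑ p ∈ antidiagonal n, u p.1 * v p.2) h2.summable

/-! ### Growth estimates for the weights and coefficients. -/

lemma exists_le_mul_pow {u : ℕ → ℝ} {ρ : ℝ} (hρ : 0 < ρ) (hu : ∀ n, 0 ≤ u n)
    (h : ∀ᶠ n in Filter.atTop, u (n + 1) ≤ ρ * u n) : ∃ K, ∀ n, u n ≤ K * ρ ^ n := by
  obtain ⟨N, hN⟩ := Filter.eventually_atTop.1 h
  refine ⟨∑ k ∈ Finset.range (N + 1), u k / ρ ^ k, fun n => ?_⟩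
  have hle : ∀ k ≤ N, u k / ρ ^ k ≤ ∑ k ∈ Finset.range (N + 1), u k / ρ ^ k := fun k hk =>
    Finset.single_le_sum (f := fun k => u k / ρ ^ k)
      (fun i _ => div_nonneg (hu i) (pow_pos hρ i).le) (Finset.mem_range.2 (by omega))
  rcases le_total n N with hn | hn
  · exact (div_le_iff₀ (pow_pos hρ n)).1 (hle n hn)
  · induction n, hn using Nat.le_induction with
    | base => exact (div_le_iff₀ (pow_pos hρ N)).1 (hle N le_rfl)
    | succ n hn ih =>
      calc u (n + 1) ≤ ρ * u n := hN n hn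
        _ ≤ ρ * (_ * ρ ^ n) := mul_le_mul_of_nonneg_left ih hρ.le
        _ = _ := by ring

/-- Ratio test: (a+n)/(b+n) tends to 1. If (b)_n vanishes eventually, the quotient is 0 by
convention and the bound persists. -/
lemma exists_norm_poch_div_poch_le (a b : ℂ) {ρ : ℝ} (hρ : 1 < ρ) :
    ∃ K, ∀ n, ‖poch a n / poch b n‖ ≤ K * ρ ^ n := by
  refine exists_le_mul_pow (by linarith) (fun n => norm_nonneg _) ?_
  have hlim : Filter.Tendsto (fun n : ℕ => (a + n) / (b + n)) Filter.atTop (nhds 1) := by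
    have h0 : ∀ z : ℂ, Filter.Tendsto (fun n : ℕ => z / n + 1) Filter.atTop (nhds 1) := by
      intro z
      simpa using (tendsto_const_div_atTop_nhds_zero_nat z).add_const 1
    have h1 := (h0 a).div (h0 b) one_ne_zero
    rw [div_one] at h1
    refine h1.congr' ?_
    filter_upwards [Filter.eventually_gt_atTop 0] with n hn
    have hn' : (n : ℂ) ≠ 0 := by exact_mod_cast hn.ne'
    simp only [Pi.div_apply]
    rw [div_add_one hn', div_add_one hn', div_div_div_cancel_right₀ hn']
  have h2 : ∀ᶠ n : ℕ in Filter.atTop, ‖(a + n) / (b + n)‖ < ρ :=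
    hlim.norm.eventually_lt_const (by simpa using hρ)
  filter_upwards [h2] with n hn
  rw [poch_succ, poch_succ, mul_div_mul_comm, norm_mul, mul_comm]
  exact mul_le_mul_of_nonneg_right hn.le (norm_nonneg _)

lemma exists_one_lt_mul_le {t δ : ℝ} (ht : 0 ≤ t) (h : t < δ) : ∃ ρ : ℝ, 1 < ρ ∧ ρ * t ≤ δ := by
  rcases ht.eq_or_lt with rfl | ht
  · exact ⟨2, by norm_num, by simpa using h.le⟩
  · exact ⟨δ / t, (one_lt_div ht).2 h, (div_mul_cancel₀ δ ht.ne').le⟩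

lemma factorialBound_poch_mul_pow (d x : ℂ) {δ : ℝ} (h : ‖x‖ < δ) :
    FactorialBound (fun n => poch d n * x ^ n) δ := by
  obtain ⟨ρ, hρ, hle⟩ := exists_one_lt_mul_le (norm_nonneg x) h
  obtain ⟨K, hK⟩ := exists_norm_poch_div_poch_le d 1 hρ
  have hK0 : 0 ≤ K := by simpa using (norm_nonneg _).trans (hK 0)
  refine ⟨K, fun n => ?_⟩
  calc ‖poch d n * x ^ n‖ = ‖poch d n / poch 1 n‖ * n.factorial * ‖x‖ ^ n := by
        rw [poch_one_left, norm_mul, norm_div, norm_pow, RCLike.norm_natCast,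
          div_mul_cancel₀ _ (by exact_mod_cast n.factorial_ne_zero)]
    _ ≤ K * ρ ^ n * n.factorial * ‖x‖ ^ n := by
        have := hK n
        gcongr
    _ = K * ((ρ * ‖x‖) ^ n * n.factorial) := by rw [mul_pow]; ring
    _ ≤ _ := by gcongr

/-- The quotient grows at most like 2^n, and any geometric sequence is O(δ^n n!) for every δ > 0. -/
lemma factorialBound_poch_div_poch_mul_pow (d e x : ℂ) {δ : ℝ} (hδ : 0 < δ) :
    FactorialBound (fun n => poch d n / poch e n * x ^ n) δ := by
  obtain ⟨K, hK⟩ := exists_norm_poch_div_poch_le d e one_lt_two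
  have hK0 : 0 ≤ K := by simpa using (norm_nonneg _).trans (hK 0)
  refine ⟨K * Real.exp (2 * ‖x‖ / δ), fun n => ?_⟩
  have h1 := Real.pow_div_factorial_le_exp (x := 2 * ‖x‖ / δ) (by positivity) n
  have hn : (n.factorial : ℝ) ≠ 0 := by exact_mod_cast n.factorial_ne_zero
  calc ‖poch d n / poch e n * x ^ n‖ = ‖poch d n / poch e n‖ * ‖x‖ ^ n := by
        rw [norm_mul, norm_pow]
    _ ≤ K * 2 ^ n * ‖x‖ ^ n := by
        have := hK n
        gcongr
    _ = K * ((2 * ‖x‖ / δ) ^ n / n.factorial) * (δ ^ n * n.factorial) := by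
        rw [div_pow, mul_pow]
        field_simp
    _ ≤ _ := by gcongr

lemma expBound_kummerSeries (a b : ℂ) {c : ℝ} (hc : 1 < c) :
    ExpBound (fun n => coeff n (kummerSeries a b)) c := by
  obtain ⟨K, hK⟩ := exists_norm_poch_div_poch_le a b hc
  refine ⟨K, fun n => ?_⟩
  beta_reduce
  rw [coeff_kummerSeries, norm_div, RCLike.norm_natCast, ← mul_div_assoc]
  have := hK n
  gcongr

lemma expBound_rescale_neg_one {f : ℂ⟦X⟧} {c : ℝ} (hf : ExpBound (fun n => coeff n f) c) :
    ExpBound (fun n => coeff n (rescale (-1) f)) c := by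
  obtain ⟨K, hK⟩ := hf
  refine ⟨K, fun n => ?_⟩
  beta_reduce
  rw [coeff_rescale, norm_mul, norm_pow, norm_neg, norm_one, one_pow, one_mul]
  exact hK n

lemma expBound_expSeries {t : ℂ} (ht : ‖t‖ = 1) {c : ℝ} (hc : 1 < c) :
    ExpBound (fun n => coeff n (expSeries t)) c := by
  refine ⟨1, fun n => ?_⟩
  beta_reduce
  rw [coeff_expSeries, norm_mul, norm_pow, ht, one_pow, one_mul, one_mul, norm_div, norm_one,
    RCLike.norm_natCast]
  gcongr
  exact one_le_pow₀ hc.le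

/-- Pairing the Pochhammer symbols, with an inserted (1)_s = s!, leaves 1/(4^s s!²), which is at
most 1/(2s)! because the central binomial coefficient is at most 4^s. -/
lemma norm_besselProdCoeff_le (a b c : ℂ) {ρ : ℝ} (hρ : 1 < ρ) :
    ∃ K, ∀ s, ‖besselProdCoeff a b c s‖ ≤ K * (ρ ^ (2 * s) / (2 * s).factorial) := by
  -- The three quotients cost σ^{3s}, which is at most σ^{4s} = ρ^{2s}.
  obtain ⟨σ, hσ, hσρ⟩ : ∃ σ : ℝ, 1 < σ ∧ σ ^ 2 = ρ :=
    ⟨√ρ, by simpa using Real.sqrt_lt_sqrt zero_le_one hρ, Real.sq_sqrt (by linarith)⟩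
  obtain ⟨K₁, h₁⟩ := exists_norm_poch_div_poch_le (c / 2) a hσ
  obtain ⟨K₂, h₂⟩ := exists_norm_poch_div_poch_le ((c + 1) / 2) b hσ
  obtain ⟨K₃, h₃⟩ := exists_norm_poch_div_poch_le 1 c hσ
  have p₁ : 0 ≤ K₁ := by simpa using (norm_nonneg _).trans (h₁ 0)
  have p₂ : 0 ≤ K₂ := by simpa using (norm_nonneg _).trans (h₂ 0)
  have p₃ : 0 ≤ K₃ := by simpa using (norm_nonneg _).trans (h₃ 0)
  refine ⟨K₁ * K₂ * K₃, fun s => ?_⟩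
  have hs : (s.factorial : ℂ) ≠ 0 := by exact_mod_cast s.factorial_ne_zero
  have e : besselProdCoeff a b c s = poch (c / 2) s / poch a s * (poch ((c + 1) / 2) s / poch b s) *
      (poch 1 s / poch c s) * (1 / (4 ^ s * s.factorial * s.factorial)) := by
    rw [besselProdCoeff, poch_one_left, one_div_pow]
    field_simp
  have hfac : ((2 * s).factorial : ℝ) ≤ 4 ^ s * s.factorial * s.factorial := by
    have h1 := Nat.add_choose_mul_factorial_mul_factorial s s
    rw [← two_mul] at h1
    have h2 := s.centralBinom_le_four_pow
    rw [Nat.centralBinom_eq_two_mul_choose] at h2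
    rw [← h1]
    push_cast
    gcongr
    exact_mod_cast h2
  rw [e, norm_mul, norm_mul, norm_mul]
  have e2 : ‖(1 / (4 ^ s * s.factorial * s.factorial) : ℂ)‖ =
      1 / (4 ^ s * s.factorial * s.factorial) := by simp
  rw [e2]
  calc _ ≤ (K₁ * σ ^ s) * (K₂ * σ ^ s) * (K₃ * σ ^ s) * (1 / (2 * s).factorial) := by
        have := h₁ s
        have := h₂ s
        have := h₃ s
        gcongr
    _ = K₁ * K₂ * K₃ * (σ ^ (3 * s) / (2 * s).factorial) := by
        rw [show 3 * s = s + s + s by ring, pow_add, pow_add]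
        ring
    _ ≤ _ := by
        rw [← hσρ, ← pow_mul]
        refine mul_le_mul_of_nonneg_left (div_le_div_of_nonneg_right
          (pow_le_pow_right₀ hσ.le (by omega)) (by positivity)) (by positivity)

lemma expBound_besselProdSeries (a b c : ℂ) {ρ : ℝ} (hρ : 1 < ρ) :
    ExpBound (fun n => coeff n (besselProdSeries a b c)) ρ := by
  obtain ⟨K, hK⟩ := norm_besselProdCoeff_le a b c hρ
  have hK0 : 0 ≤ K := by simpa using (norm_nonneg _).trans (hK 0)
  refine ⟨K, fun n => ?_⟩
  beta_reduce
  rw [besselProdSeries, coeff_expand]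
  split_ifs with h
  · obtain ⟨s, rfl⟩ := h
    rw [coeff_mk, Nat.mul_div_cancel_left s two_pos]
    exact hK s
  · rw [norm_zero]
    positivity

/-! ### Weighted sums of formal identities. -/

section

variable {w : ℕ → ℂ} {δ : ℝ}

lemma exists_one_lt_mul_lt_one {N : ℝ} (hδ : 0 ≤ δ) (hN : 0 ≤ N) (h : N * δ < 1) :
    ∃ c : ℝ, 1 < c ∧ δ * (c * N) < 1 := by
  obtain ⟨t, h1, h2⟩ := exists_between h
  obtain ⟨c, hc, hle⟩ := exists_one_lt_mul_le (mul_nonneg hN hδ) h1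
  exact ⟨c, hc, lt_of_le_of_lt (by linarith) h2⟩

lemma summable_weighted_series_mul (hδ : 0 ≤ δ) (h : 2 * δ < 1) (hw : FactorialBound w δ)
    {f g : ℂ⟦X⟧} (hf : ∀ c : ℝ, 1 < c → ExpBound (fun n => coeff n f) c)
    (hg : ∀ c : ℝ, 1 < c → ExpBound (fun n => coeff n g) c) :
    Summable fun i : ℕ × ℕ => w (i.1 + i.2) * (coeff i.1 f * coeff i.2 g) := by
  obtain ⟨c, hc, hlt⟩ := exists_one_lt_mul_lt_one hδ zero_le_two h
  have hc0 : 0 ≤ c := by linarith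
  have hcc : δ * (c + c) < 1 := by rwa [← mul_two]
  exact summable_weighted_mul (u := fun n => coeff n f) (v := fun n => coeff n g) hδ hc0 hc0 hcc hw
    (hf c hc) (hg c hc)

lemma hasSum_weighted_series_mul {f g : ℂ⟦X⟧}
    (h : Summable fun i : ℕ × ℕ => w (i.1 + i.2) * (coeff i.1 f * coeff i.2 g)) :
    HasSum (fun n => w n * coeff n (f * g))
      (∑' i : ℕ × ℕ, w (i.1 + i.2) * (coeff i.1 f * coeff i.2 g)) := by
  simp only [coeff_mul]
  exact hasSum_weighted_antidiagonal (u := fun n => coeff n f) (v := fun n => coeff n g) h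

/-- Only even exponents of the Bessel product contribute; the injection (r, s) ↦ (r, 2s) produces
the degree r+2s of the S-function. -/
lemma weighted_exp_mul_besselProdSeries (a b c : ℂ) (hδ : 0 ≤ δ) (h : 2 * δ < 1)
    (hw : FactorialBound w δ) :
    (Summable fun i : ℕ × ℕ =>
      w (i.1 + 2 * i.2) * (1 / i.1.factorial * besselProdCoeff a b c i.2)) ∧
    HasSum (fun n => w n * coeff n (expSeries 1 * besselProdSeries a b c))
      (∑' i : ℕ × ℕ, w (i.1 + 2 * i.2) * (1 / i.1.factorial * besselProdCoeff a b c i.2)) := by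
  have h1 := summable_weighted_series_mul hδ h hw (f := expSeries 1)
    (g := besselProdSeries a b c) (fun _ => expBound_expSeries norm_one)
    (fun _ => expBound_besselProdSeries a b c)
  have h2 := hasSum_weighted_series_mul h1
  have hinj : Function.Injective fun i : ℕ × ℕ => (i.1, 2 * i.2) := by
    rintro ⟨r, s⟩ ⟨r', s'⟩ hi
    simp only [Prod.mk.injEq] at hi
    ext
    · exact hi.1
    · exact Nat.eq_of_mul_eq_mul_left two_pos hi.2
  have h3 : HasSum (fun i : ℕ × ℕ =>
      w (i.1 + 2 * i.2) * (1 / i.1.factorial * besselProdCoeff a b c i.2))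
      (∑' i : ℕ × ℕ, w (i.1 + i.2) *
        (coeff i.1 (expSeries 1) * coeff i.2 (besselProdSeries a b c))) := by
    refine ((hinj.hasSum_iff ?_).2 h1.hasSum).congr_fun fun i => ?_
    · rintro ⟨r, q⟩ hq
      have hq' : ¬ 2 ∣ q := by
        rintro ⟨s, rfl⟩
        exact hq ⟨(r, s), rfl⟩
      rw [besselProdSeries, coeff_expand, if_neg hq', mul_zero, mul_zero]
    · simp only [Function.comp_apply]
      rw [besselProdSeries, coeff_expand_mul, coeff_mk, coeff_expSeries, one_pow, one_mul]
  exact ⟨h3.summable, by rwa [h3.tsum_eq]⟩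

lemma weighted_besselProdSeries (a b c : ℂ) (hδ : 0 ≤ δ) (h : 2 * δ < 1)
    (hw : FactorialBound w δ) :
    (Summable fun s : ℕ => w (2 * s) * besselProdCoeff a b c s) ∧
    HasSum (fun n => w n * coeff n (besselProdSeries a b c))
      (∑' s : ℕ, w (2 * s) * besselProdCoeff a b c s) := by
  obtain ⟨t, ht, hlt⟩ := exists_one_lt_mul_lt_one hδ zero_le_two h
  have hs : Summable fun n => w n * coeff n (besselProdSeries a b c) := by
    obtain ⟨J, hJ⟩ := hw
    obtain ⟨K, hK⟩ := expBound_besselProdSeries a b c ht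
    have ht0 : 0 ≤ t := by linarith
    have hδt : 0 ≤ δ * t := by positivity
    refine Summable.of_norm_bounded
      ((summable_geometric_of_lt_one hδt (by linarith)).mul_left (J * K)) fun n => ?_
    have hn : (n.factorial : ℝ) ≠ 0 := by exact_mod_cast n.factorial_ne_zero
    rw [norm_mul]
    calc _ ≤ (J * (δ ^ n * n.factorial)) * (K * (t ^ n / n.factorial)) :=
          mul_le_mul (hJ n) (hK n) (norm_nonneg _) ((norm_nonneg _).trans (hJ n))
      _ = _ := by
          rw [mul_pow]
          field_simp
  have hinj : Function.Injective fun s : ℕ => 2 * s :=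
    fun s s' hs => Nat.eq_of_mul_eq_mul_left two_pos hs
  have h3 : HasSum (fun s : ℕ => w (2 * s) * besselProdCoeff a b c s)
      (∑' n, w n * coeff n (besselProdSeries a b c)) := by
    refine ((hinj.hasSum_iff ?_).2 hs.hasSum).congr_fun fun s => ?_
    · intro q hq
      have hq' : ¬ 2 ∣ q := by
        rintro ⟨s, rfl⟩
        exact hq ⟨s, rfl⟩
      rw [besselProdSeries, coeff_expand, if_neg hq', mul_zero]
    · simp only [Function.comp_apply]
      rw [besselProdSeries, coeff_expand_mul, coeff_mk]
  exact ⟨h3.summable, by rw [h3.tsum_eq]; exact hs.hasSum⟩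

/-- Multiplication by X^M moves the weight from N to M+N, whose constant part κ factors out. -/
lemma hasSum_weighted_X_pow_mul {w' : ℕ → ℂ} {κ : ℂ} {M : ℕ} (hw : ∀ N, w (M + N) = κ * w' N)
    {f : ℂ⟦X⟧} {s : ℂ} (h : HasSum (fun N => w' N * coeff N f) s) :
    HasSum (fun N => w N * coeff N (X ^ M * f)) (κ * s) := by
  refine ((add_right_injective M).hasSum_iff fun N hN => ?_).1
    ((h.mul_left κ).congr_fun fun N => ?_)
  · rw [coeff_X_pow_mul', if_neg, mul_zero]
    exact fun hle => hN ⟨N - M, Nat.add_sub_cancel' hle⟩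
  · simp only [Function.comp_apply]
    rw [hw, add_comm M N, coeff_X_pow_mul, mul_assoc]

lemma hasSum_weighted_double_sum {w' : ℕ → ℕ → ℂ} {κ : ℕ → ℂ}
    (hw : ∀ M N, w (M + N) = κ M * w' M N) (m n : ℕ) (C' : ℕ → ℕ → ℂ) {f : ℕ → ℕ → ℂ⟦X⟧}
    {s : ℕ → ℕ → ℂ} (h : ∀ j k, HasSum (fun N => w' (j + k) N * coeff N (f j k)) (s j k)) :
    HasSum (fun N => w N * coeff N (∑ j ∈ Finset.range (m + 1), ∑ k ∈ Finset.range (n + 1),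
        C (C' j k) * (X ^ (j + k) * f j k)))
      (∑ j ∈ Finset.range (m + 1), ∑ k ∈ Finset.range (n + 1),
        C' j k * (κ (j + k) * s j k)) := by
  simp only [map_sum, coeff_C_mul, Finset.mul_sum]
  refine hasSum_sum fun j _ => hasSum_sum fun k _ => ?_
  refine ((hasSum_weighted_X_pow_mul (hw (j + k)) (h j k)).mul_left (C' j k)).congr_fun
    fun N => ?_
  ring

end

section

variable {w : ℕ → ℂ} {w' : ℕ → ℕ → ℂ} {κ : ℕ → ℂ} {δ : ℝ} {a b : ℂ} {m n : ℕ}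

lemma FactorialBound.of_shift (hw : ∀ M N, w (M + N) = κ M * w' M N)
    (hb : ∀ M, FactorialBound (w' M) δ) : FactorialBound w δ := by
  obtain ⟨K, hK⟩ := hb 0
  refine ⟨‖κ 0‖ * K, fun N => ?_⟩
  have h := hw 0 N
  rw [zero_add] at h
  rw [h, norm_mul, mul_assoc]
  exact mul_le_mul_of_nonneg_left (hK N) (norm_nonneg _)

/-- Here `w' M` is the weight with parameters shifted by M. The factor e^X from Kummer's first
theorem stays inside each term. -/
lemma weighted_kummer_mul_kummer (hw : ∀ M N, w (M + N) = κ M * w' M N) (hδ : 0 ≤ δ)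
    (hδ2 : 2 * δ < 1) (hB : ∀ M, FactorialBound (w' M) δ) (h2a : ∀ l : ℕ, 2 * a + m ≠ -l)
    (h2b : ∀ l : ℕ, 2 * b - n ≠ -l)
    (ha : ∀ l < m, a - 1 / 2 ≠ -l) (ha' : ∀ l : ℕ, a + 1 / 2 ≠ -l)
    (hb : ∀ l < n, b - n - 1 / 2 ≠ -l) (hb' : ∀ l : ℕ, b - n + 1 / 2 ≠ -l)
    (hab : ∀ l : ℕ, a + b - n ≠ -l) :
    (Summable fun i : ℕ × ℕ => w (i.1 + i.2) *
      (coeff i.1 (kummerSeries a (2 * a + m)) * coeff i.2 (kummerSeries b (2 * b - n)))) ∧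
    (∑' i : ℕ × ℕ, w (i.1 + i.2) *
      (coeff i.1 (kummerSeries a (2 * a + m)) * coeff i.2 (kummerSeries b (2 * b - n)))) =
    ∑ j ∈ Finset.range (m + 1), ∑ k ∈ Finset.range (n + 1),
      kummerProdCoeff a b m n j k * (κ (j + k) * ∑' i : ℕ × ℕ, w' (j + k) (i.1 + 2 * i.2) *
        (1 / i.1.factorial * besselProdCoeff (a + j + 1 / 2) (b + k - n + 1 / 2)
          (a + b + j + k - n) i.2)) := by
  have hs := summable_weighted_series_mul hδ hδ2 (FactorialBound.of_shift hw hB)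
    (f := kummerSeries a (2 * a + m)) (g := kummerSeries b (2 * b - n))
    (fun _ => expBound_kummerSeries a (2 * a + m)) (fun _ => expBound_kummerSeries b (2 * b - n))
  refine ⟨hs, (hasSum_weighted_series_mul hs).unique ?_⟩
  have h := hasSum_weighted_double_sum hw m n (kummerProdCoeff a b m n)
    (f := fun j k => expSeries 1 * besselProdSeries (a + j + 1 / 2) (b + k - n + 1 / 2)
      (a + b + j + k - n))
    (s := fun j k => ∑' i : ℕ × ℕ, w' (j + k) (i.1 + 2 * i.2) *
        (1 / i.1.factorial * besselProdCoeff (a + j + 1 / 2) (b + k - n + 1 / 2)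
          (a + b + j + k - n) i.2)) fun j k =>
    (weighted_exp_mul_besselProdSeries (a + j + 1 / 2) (b + k - n + 1 / 2)
      (a + b + j + k - n) hδ hδ2 (hB (j + k))).2
  have e : kummerSeries a (2 * a + m) * kummerSeries b (2 * b - n) =
      ∑ j ∈ Finset.range (m + 1), ∑ k ∈ Finset.range (n + 1),
        C (kummerProdCoeff a b m n j k) * (X ^ (j + k) * (expSeries 1 *
          besselProdSeries (a + j + 1 / 2) (b + k - n + 1 / 2) (a + b + j + k - n))) := by
    rw [kummerSeries_eq_exp_mul_rescale b n h2b, mul_left_comm,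
      kummerSeries_mul_rescale a b m n h2a h2b ha ha' hb hb' hab, Finset.mul_sum]
    refine Finset.sum_congr rfl fun j _ => ?_
    rw [Finset.mul_sum]
    refine Finset.sum_congr rfl fun k _ => ?_
    ring
  rw [e]
  exact h

lemma weighted_kummer_mul_rescale (hw : ∀ M N, w (M + N) = κ M * w' M N) (hδ : 0 ≤ δ)
    (hδ2 : 2 * δ < 1) (hB : ∀ M, FactorialBound (w' M) δ) (h2a : ∀ l : ℕ, 2 * a + m ≠ -l)
    (h2b : ∀ l : ℕ, 2 * b - n ≠ -l)
    (ha : ∀ l < m, a - 1 / 2 ≠ -l) (ha' : ∀ l : ℕ, a + 1 / 2 ≠ -l)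
    (hb : ∀ l < n, b - n - 1 / 2 ≠ -l) (hb' : ∀ l : ℕ, b - n + 1 / 2 ≠ -l)
    (hab : ∀ l : ℕ, a + b - n ≠ -l) :
    (Summable fun i : ℕ × ℕ => w (i.1 + i.2) * (coeff i.1 (kummerSeries a (2 * a + m)) *
      coeff i.2 (rescale (-1) (kummerSeries (b - n) (2 * b - n))))) ∧
    (∑' i : ℕ × ℕ, w (i.1 + i.2) * (coeff i.1 (kummerSeries a (2 * a + m)) *
      coeff i.2 (rescale (-1) (kummerSeries (b - n) (2 * b - n))))) =
    ∑ j ∈ Finset.range (m + 1), ∑ k ∈ Finset.range (n + 1),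
      kummerProdCoeff a b m n j k * (κ (j + k) * ∑' s : ℕ, w' (j + k) (2 * s) *
        besselProdCoeff (a + j + 1 / 2) (b + k - n + 1 / 2) (a + b + j + k - n) s) := by
  have hs := summable_weighted_series_mul hδ hδ2 (FactorialBound.of_shift hw hB)
    (f := kummerSeries a (2 * a + m)) (g := rescale (-1) (kummerSeries (b - n) (2 * b - n)))
    (fun _ => expBound_kummerSeries a (2 * a + m))
    (fun _ hc => expBound_rescale_neg_one (expBound_kummerSeries (b - n) (2 * b - n) hc))
  refine ⟨hs, (hasSum_weighted_series_mul hs).unique ?_⟩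
  rw [kummerSeries_mul_rescale a b m n h2a h2b ha ha' hb hb' hab]
  exact hasSum_weighted_double_sum hw m n (kummerProdCoeff a b m n) fun j k =>
    (weighted_besselProdSeries (a + j + 1 / 2) (b + k - n + 1 / 2)
      (a + b + j + k - n) hδ hδ2 (hB (j + k))).2

/-- Since e^{-X} ₁F₁[b; 2b-n | X] = ₁F₁[b-n; 2b-n | -X], the double and triple sums collapse to the
same series in N. -/
lemma weighted_exp_mul_kummer_mul_kummer (hδ : 0 ≤ δ) (hδ3 : 3 * δ < 1)
    (hB : FactorialBound w δ) (h2b : ∀ l : ℕ, 2 * b - n ≠ -l) :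
    (Summable fun i : ℕ × ℕ × ℕ => w (i.1 + (i.2.1 + i.2.2)) * (coeff i.1 (expSeries (-1)) *
      (coeff i.2.1 (kummerSeries a (2 * a + m)) * coeff i.2.2 (kummerSeries b (2 * b - n))))) ∧
    (∑' i : ℕ × ℕ, w (i.1 + i.2) * (coeff i.1 (kummerSeries a (2 * a + m)) *
      coeff i.2 (rescale (-1) (kummerSeries (b - n) (2 * b - n))))) =
    ∑' i : ℕ × ℕ × ℕ, w (i.1 + (i.2.1 + i.2.2)) * (coeff i.1 (expSeries (-1)) *
      (coeff i.2.1 (kummerSeries a (2 * a + m)) *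
        coeff i.2.2 (kummerSeries b (2 * b - n)))) := by
  obtain ⟨c, hc, hlt⟩ := exists_one_lt_mul_lt_one hδ (by norm_num : (0 : ℝ) ≤ 3) hδ3
  have hc0 : 0 ≤ c := by linarith
  have h3 := summable_weighted_triple
    (t := fun r => coeff r (expSeries (-1)))
    (u := fun p => coeff p (kummerSeries a (2 * a + m)))
    (v := fun q => coeff q (kummerSeries b (2 * b - n))) hδ hc0 hc0 hc0 (by linarith) hB
    (expBound_expSeries (t := -1) (by simp) hc) (expBound_kummerSeries a (2 * a + m) hc)
    (expBound_kummerSeries b (2 * b - n) hc)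
  refine ⟨h3, ?_⟩
  have hs := summable_weighted_series_mul hδ (by linarith) hB
    (f := kummerSeries a (2 * a + m)) (g := rescale (-1) (kummerSeries (b - n) (2 * b - n)))
    (fun _ => expBound_kummerSeries a (2 * a + m))
    (fun _ hc => expBound_rescale_neg_one (expBound_kummerSeries (b - n) (2 * b - n) hc))
  refine (hasSum_weighted_series_mul hs).unique ((hasSum_weighted_triple
    (t := fun r => coeff r (expSeries (-1)))
    (u := fun p => coeff p (kummerSeries a (2 * a + m)))
    (v := fun q => coeff q (kummerSeries b (2 * b - n))) h3).congr_fun fun N => ?_)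
  rw [← expSeries_neg_one_mul_kummerSeries b n h2b, mul_left_comm, coeff_mul]
  simp only [coeff_mul]

end

/-! ### Hypergeometric terms as weighted coefficients. -/

lemma pochProd_nil (n : ℕ) : pochProd [] n = 1 := by simp [pochProd]

lemma pochProd_singleton (a : ℂ) (n : ℕ) : pochProd [a] n = poch a n := by simp [pochProd]

section

variable (d e a a' b b' x : ℂ)

lemma kdfTerm_eq : kdfTerm [d] [a] [b] [e] [a'] [b'] x x = fun i =>
    poch d (i.1 + i.2) / poch e (i.1 + i.2) * x ^ (i.1 + i.2) *
      (coeff i.1 (kummerSeries a a') * coeff i.2 (kummerSeries b b')) := by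
  ext i
  simp only [kdfTerm, pochProd_singleton, coeff_kummerSeries, pow_add]
  ring

lemma kdfTerm_nil_eq : kdfTerm [d] [a] [b] [] [a'] [b'] x x = fun i =>
    poch d (i.1 + i.2) * x ^ (i.1 + i.2) *
      (coeff i.1 (kummerSeries a a') * coeff i.2 (kummerSeries b b')) := by
  ext i
  simp only [kdfTerm, pochProd_singleton, pochProd_nil, coeff_kummerSeries, pow_add]
  ring

lemma kdfTerm_neg_eq : kdfTerm [d] [a] [b] [e] [a'] [b'] x (-x) = fun i =>
    poch d (i.1 + i.2) / poch e (i.1 + i.2) * x ^ (i.1 + i.2) *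
      (coeff i.1 (kummerSeries a a') * coeff i.2 (rescale (-1) (kummerSeries b b'))) := by
  ext i
  simp only [kdfTerm, pochProd_singleton, coeff_rescale, coeff_kummerSeries, pow_add, neg_pow x]
  ring

lemma kdfTerm_nil_neg_eq : kdfTerm [d] [a] [b] [] [a'] [b'] x (-x) = fun i =>
    poch d (i.1 + i.2) * x ^ (i.1 + i.2) *
      (coeff i.1 (kummerSeries a a') * coeff i.2 (rescale (-1) (kummerSeries b b'))) := by
  ext i
  simp only [kdfTerm, pochProd_singleton, pochProd_nil, coeff_rescale, coeff_kummerSeries, pow_add,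
    neg_pow x]
  ring

lemma tripleTerm_eq :
    tripleTerm [d] [] [] [] [] [a] [b] [e] [] [] [] [] [a'] [b'] (-x) x x = fun i =>
    poch d (i.1 + (i.2.1 + i.2.2)) / poch e (i.1 + (i.2.1 + i.2.2)) *
      x ^ (i.1 + (i.2.1 + i.2.2)) * (coeff i.1 (expSeries (-1)) *
        (coeff i.2.1 (kummerSeries a a') * coeff i.2.2 (kummerSeries b b'))) := by
  ext i
  simp only [tripleTerm, pochProd_singleton, pochProd_nil, coeff_expSeries, coeff_kummerSeries,
    add_assoc]
  simp only [pow_add, neg_pow x]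
  ring

lemma tripleTerm_nil_eq :
    tripleTerm [d] [] [] [] [] [a] [b] [] [] [] [] [] [a'] [b'] (-x) x x = fun i =>
    poch d (i.1 + (i.2.1 + i.2.2)) *
      x ^ (i.1 + (i.2.1 + i.2.2)) * (coeff i.1 (expSeries (-1)) *
        (coeff i.2.1 (kummerSeries a a') * coeff i.2.2 (kummerSeries b b'))) := by
  ext i
  simp only [tripleTerm, pochProd_singleton, pochProd_nil, coeff_expSeries, coeff_kummerSeries,
    add_assoc]
  simp only [pow_add, neg_pow x]
  ring

lemma srivastavaTerm_eq (c : ℂ) :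
    srivastavaTerm [(d, 1, 2)] [] [(c / 2, 1), ((c + 1) / 2, 1)] [(e, 1, 2)] []
      [(a, 1), (b, 1), (c, 1)] x (x ^ 2 / 4) = fun i =>
    poch d (i.1 + 2 * i.2) / poch e (i.1 + 2 * i.2) * x ^ (i.1 + 2 * i.2) *
      (1 / i.1.factorial * besselProdCoeff a b c i.2) := by
  ext i
  simp only [srivastavaTerm, pochProd₂, pochProd₁, besselProdCoeff, List.map_cons, List.map_nil,
    List.prod_cons, List.prod_nil, mul_one, mul_comm i.2 2, div_pow, pow_add, pow_mul, one_pow]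
  ring

lemma srivastavaTerm_nil_eq (c : ℂ) :
    srivastavaTerm [(d, 1, 2)] [] [(c / 2, 1), ((c + 1) / 2, 1)] [] []
      [(a, 1), (b, 1), (c, 1)] x (x ^ 2 / 4) = fun i =>
    poch d (i.1 + 2 * i.2) * x ^ (i.1 + 2 * i.2) *
      (1 / i.1.factorial * besselProdCoeff a b c i.2) := by
  ext i
  simp only [srivastavaTerm, pochProd₂, pochProd₁, besselProdCoeff, List.map_cons, List.map_nil,
    List.prod_cons, List.prod_nil, mul_one, mul_comm i.2 2, div_pow, pow_add, pow_mul, one_pow]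
  ring

/-- The powers 4^s from duplicating (d)_{2s} and (e)_{2s} cancel, so the argument is x²/4. -/
lemma genHypTerm_eq (c : ℂ) :
    genHypTerm [c / 2, (c + 1) / 2, d / 2, (d + 1) / 2] [a, b, c, e / 2, (e + 1) / 2]
      (x ^ 2 / 4) = fun s =>
    poch d (2 * s) / poch e (2 * s) * x ^ (2 * s) * besselProdCoeff a b c s := by
  ext s
  have h4 : (4 : ℂ) ^ s ≠ 0 := by simp
  simp only [genHypTerm, pochProd, besselProdCoeff, List.map_cons, List.map_nil,
    List.prod_cons, List.prod_nil, mul_one, div_pow, pow_mul, one_pow, poch_two_mul, mul_assoc,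
    mul_div_mul_left _ _ h4]
  ring

/-- Without e the factor 4^s from (d)_{2s} survives and cancels the 1/4, so the argument is x². -/
lemma genHypTerm_nil_eq (c : ℂ) :
    genHypTerm [c / 2, (c + 1) / 2, d / 2, (d + 1) / 2] [a, b, c] (x ^ 2) = fun s =>
    poch d (2 * s) * x ^ (2 * s) * besselProdCoeff a b c s := by
  ext s
  have h4 : (4 : ℂ) ^ s ≠ 0 := by simp
  simp only [genHypTerm, pochProd, besselProdCoeff, List.map_cons, List.map_nil,
    List.prod_cons, List.prod_nil, mul_one, pow_mul, poch_two_mul, one_div_pow]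
  field_simp

end

/-! ### Shifted weights and assembly of the theorem. -/

lemma poch_mul_pow_add (d x : ℂ) (M N : ℕ) :
    poch d (M + N) * x ^ (M + N) = poch d M * x ^ M * (poch (d + M) N * x ^ N) := by
  rw [poch_add, pow_add]
  ring

lemma poch_div_poch_mul_pow_add (d e x : ℂ) (M N : ℕ) :
    poch d (M + N) / poch e (M + N) * x ^ (M + N) =
      poch d M / poch e M * x ^ M * (poch (d + M) N / poch (e + M) N * x ^ N) := by
  rw [poch_add, poch_add, pow_add]
  ring

lemma kummerProdCoeff_eq (a b : ℂ) (m n j k : ℕ) : kummerProdCoeff a b m n j k =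
    (-1) ^ k * poch (-m) j * poch (-n) k * poch (2 * a - 1) j * poch (2 * b - 2 * n - 1) k /
      (poch (2 * a + m) j * poch (2 * b - n) k * poch (a - 1 / 2) j * poch (b - n - 1 / 2) k *
        2 ^ (2 * j + 2 * k) * (j.factorial : ℂ) * (k.factorial : ℂ)) := by
  rw [kummerProdCoeff, kummerCoeff, kummerCoeff, show 2 * (b - n) - 1 = 2 * b - 2 * n - 1 by ring,
    show 2 * (b - n) + n = 2 * b - n by ring, pow_add, pow_mul, pow_mul,
    show (2 : ℂ) ^ 2 = 4 by norm_num]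
  ring

theorem theorem3 (m n : ℕ) (d e α β : ℂ) (hd : 0 < d.re) (hde : d.re < e.re)
    (h2α : ∀ l : ℕ, 2 * α + m ≠ -l) (h2β : ∀ l : ℕ, 2 * β - n ≠ -l)
    (hα : ∀ l < m, α - 1 / 2 ≠ -l) (hα' : ∀ l : ℕ, α + 1 / 2 ≠ -l)
    (hβ : ∀ l < n, β - n - 1 / 2 ≠ -l) (hβ' : ∀ l : ℕ, β - n + 1 / 2 ≠ -l)
    (hαβ : ∀ l : ℕ, α + β - n ≠ -l) :
    (∀ x : ℂ,
      Summable (kdfTerm [d] [α] [β] [e] [2 * α + m] [2 * β - n] x x) ∧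
      (∀ j ≤ m, ∀ k ≤ n, Summable (
            srivastavaTerm [(d + j + k, 1, 2)] []
              [((α + β + j + k - n) / 2, 1), ((α + β + j + k - n + 1) / 2, 1)]
              [(e + j + k, 1, 2)] []
              [(α + j + 1 / 2, 1), (β + k - n + 1 / 2, 1), (α + β + j + k - n, 1)]
              x (x ^ 2 / 4))) ∧
      kdf [d] [α] [β] [e] [2 * α + m] [2 * β - n] x x =
        ∑ j ∈ Finset.range (m + 1), ∑ k ∈ Finset.range (n + 1),
          (poch d (j + k) * (-1) ^ k * poch (-m) j * poch (-n) k *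
              poch (2 * α - 1) j * poch (2 * β - 2 * n - 1) k * x ^ (j + k)) /
            (poch e (j + k) * poch (2 * α + m) j * poch (2 * β - n) k *
              poch (α - 1 / 2) j * poch (β - n - 1 / 2) k *
              2 ^ (2 * j + 2 * k) * (j.factorial : ℂ) * (k.factorial : ℂ)) *
            srivastavaS [(d + j + k, 1, 2)] []
              [((α + β + j + k - n) / 2, 1), ((α + β + j + k - n + 1) / 2, 1)]
              [(e + j + k, 1, 2)] []
              [(α + j + 1 / 2, 1), (β + k - n + 1 / 2, 1), (α + β + j + k - n, 1)]
              x (x ^ 2 / 4)) ∧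
    (∀ x : ℂ,
      Summable (kdfTerm [d] [α] [β - n] [e] [2 * α + m] [2 * β - n] x (-x)) ∧
      (∀ j ≤ m, ∀ k ≤ n, Summable (
            genHypTerm [(α + β + j + k - n) / 2, (α + β + j + k - n + 1) / 2,
                (d + j + k) / 2, (d + j + k + 1) / 2]
              [α + j + 1 / 2, β + k - n + 1 / 2, α + β + j + k - n,
                (e + j + k) / 2, (e + j + k + 1) / 2]
              (x ^ 2 / 4))) ∧
      kdf [d] [α] [β - n] [e] [2 * α + m] [2 * β - n] x (-x) =
        ∑ j ∈ Finset.range (m + 1), ∑ k ∈ Finset.range (n + 1),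
          (poch d (j + k) * (-1) ^ k * poch (-m) j * poch (-n) k *
              poch (2 * α - 1) j * poch (2 * β - 2 * n - 1) k * x ^ (j + k)) /
            (poch e (j + k) * poch (2 * α + m) j * poch (2 * β - n) k *
              poch (α - 1 / 2) j * poch (β - n - 1 / 2) k *
              2 ^ (2 * j + 2 * k) * (j.factorial : ℂ) * (k.factorial : ℂ)) *
            genHyp [(α + β + j + k - n) / 2, (α + β + j + k - n + 1) / 2,
                (d + j + k) / 2, (d + j + k + 1) / 2]
              [α + j + 1 / 2, β + k - n + 1 / 2, α + β + j + k - n,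
                (e + j + k) / 2, (e + j + k + 1) / 2]
              (x ^ 2 / 4)) ∧
    (∀ x : ℂ,
      Summable (tripleTerm [d] [] [] [] [] [α] [β] [e] [] [] [] [] [2 * α + m] [2 * β - n] (-x) x x) ∧
      kdf [d] [α] [β - n] [e] [2 * α + m] [2 * β - n] x (-x) =
        triple [d] [] [] [] [] [α] [β] [e] [] [] [] [] [2 * α + m] [2 * β - n] (-x) x x) ∧
    (∀ x : ℂ, ‖x‖ < 1 / 2 →
      Summable (kdfTerm [d] [α] [β] [] [2 * α + m] [2 * β - n] x x) ∧
      (∀ j ≤ m, ∀ k ≤ n, Summable (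
            srivastavaTerm [(d + j + k, 1, 2)] []
              [((α + β + j + k - n) / 2, 1), ((α + β + j + k - n + 1) / 2, 1)]
              [] []
              [(α + j + 1 / 2, 1), (β + k - n + 1 / 2, 1), (α + β + j + k - n, 1)]
              x (x ^ 2 / 4))) ∧
      kdf [d] [α] [β] [] [2 * α + m] [2 * β - n] x x =
        ∑ j ∈ Finset.range (m + 1), ∑ k ∈ Finset.range (n + 1),
          (poch d (j + k) * (-1) ^ k * poch (-m) j * poch (-n) k *
              poch (2 * α - 1) j * poch (2 * β - 2 * n - 1) k * x ^ (j + k)) /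
            (poch (2 * α + m) j * poch (2 * β - n) k *
              poch (α - 1 / 2) j * poch (β - n - 1 / 2) k *
              2 ^ (2 * j + 2 * k) * (j.factorial : ℂ) * (k.factorial : ℂ)) *
            srivastavaS [(d + j + k, 1, 2)] []
              [((α + β + j + k - n) / 2, 1), ((α + β + j + k - n + 1) / 2, 1)]
              [] []
              [(α + j + 1 / 2, 1), (β + k - n + 1 / 2, 1), (α + β + j + k - n, 1)]
              x (x ^ 2 / 4)) ∧
    (∀ x : ℂ, ‖x‖ < 1 / 2 →
      Summable (kdfTerm [d] [α] [β - n] [] [2 * α + m] [2 * β - n] x (-x)) ∧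
      (∀ j ≤ m, ∀ k ≤ n, Summable (
            genHypTerm [(α + β + j + k - n) / 2, (α + β + j + k - n + 1) / 2,
                (d + j + k) / 2, (d + j + k + 1) / 2]
              [α + j + 1 / 2, β + k - n + 1 / 2, α + β + j + k - n]
              (x ^ 2))) ∧
      kdf [d] [α] [β - n] [] [2 * α + m] [2 * β - n] x (-x) =
        ∑ j ∈ Finset.range (m + 1), ∑ k ∈ Finset.range (n + 1),
          (poch d (j + k) * (-1) ^ k * poch (-m) j * poch (-n) k *
              poch (2 * α - 1) j * poch (2 * β - 2 * n - 1) k * x ^ (j + k)) /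
            (poch (2 * α + m) j * poch (2 * β - n) k *
              poch (α - 1 / 2) j * poch (β - n - 1 / 2) k *
              2 ^ (2 * j + 2 * k) * (j.factorial : ℂ) * (k.factorial : ℂ)) *
            genHyp [(α + β + j + k - n) / 2, (α + β + j + k - n + 1) / 2,
                (d + j + k) / 2, (d + j + k + 1) / 2]
              [α + j + 1 / 2, β + k - n + 1 / 2, α + β + j + k - n]
              (x ^ 2)) ∧
    (∀ x : ℂ, ‖x‖ < 1 / 3 →
      Summable (tripleTerm [d] [] [] [] [] [α] [β] [] [] [] [] [] [2 * α + m] [2 * β - n] (-x) x x) ∧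
      kdf [d] [α] [β - n] [] [2 * α + m] [2 * β - n] x (-x) =
        triple [d] [] [] [] [] [α] [β] [] [] [] [] [] [2 * α + m] [2 * β - n] (-x) x x) := by

  have hcast : ∀ (z : ℂ) (j k : ℕ), z + j + k = z + (j + k : ℕ) := fun z j k => by
    push_cast
    ring
  -- Any positive δ is available when e is present; 1/4 satisfies both 2δ < 1 and 3δ < 1.
  have hE : ∀ x : ℂ, ∀ M : ℕ,
      FactorialBound (fun N => poch (d + M) N / poch (e + M) N * x ^ N) (1 / 4) :=
    fun x M => factorialBound_poch_div_poch_mul_pow _ _ x (by norm_num)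
  have hN : ∀ (x : ℂ) (t : ℝ), ‖x‖ < t → ∀ M : ℕ,
      FactorialBound (fun N => poch (d + M) N * x ^ N) t :=
    fun x t hx M => factorialBound_poch_mul_pow _ x hx
  have hhalf : ∀ x : ℂ, ‖x‖ < 1 / 2 → ∃ t : ℝ, ‖x‖ < t ∧ 0 ≤ t ∧ 2 * t < 1 := by
    intro x hx
    obtain ⟨t, h1, h2⟩ := exists_between hx
    exact ⟨t, h1, (norm_nonneg x).trans h1.le, by linarith⟩
  refine ⟨fun x => ?_, fun x => ?_, fun x => ?_, fun x hx => ?_, fun x hx => ?_, fun x hx => ?_⟩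
  · obtain ⟨h1, h2⟩ := weighted_kummer_mul_kummer
      (w := fun N => poch d N / poch e N * x ^ N) (κ := fun M => poch d M / poch e M * x ^ M)
      (poch_div_poch_mul_pow_add d e x) (by norm_num)
      (by norm_num) (hE x) h2α h2β hα hα' hβ hβ' hαβ
    refine ⟨by rw [kdfTerm_eq]; exact h1, fun j _ k _ => ?_, ?_⟩
    · rw [srivastavaTerm_eq, hcast d, hcast e]
      exact (weighted_exp_mul_besselProdSeries _ _ _ (by norm_num) (by norm_num)
        (hE x (j + k))).1
    · rw [kdf, kdfTerm_eq, h2]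
      refine Finset.sum_congr rfl fun j _ => Finset.sum_congr rfl fun k _ => ?_
      rw [srivastavaS, srivastavaTerm_eq, hcast d, hcast e, kummerProdCoeff_eq]
      ring
  · obtain ⟨h1, h2⟩ := weighted_kummer_mul_rescale
      (w := fun N => poch d N / poch e N * x ^ N) (κ := fun M => poch d M / poch e M * x ^ M)
      (poch_div_poch_mul_pow_add d e x) (by norm_num)
      (by norm_num) (hE x) h2α h2β hα hα' hβ hβ' hαβ
    refine ⟨by rw [kdfTerm_neg_eq]; exact h1, fun j _ k _ => ?_, ?_⟩
    · rw [genHypTerm_eq, hcast d, hcast e]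
      exact (weighted_besselProdSeries _ _ _ (by norm_num) (by norm_num) (hE x (j + k))).1
    · rw [kdf, kdfTerm_neg_eq, h2]
      refine Finset.sum_congr rfl fun j _ => Finset.sum_congr rfl fun k _ => ?_
      rw [genHyp, genHypTerm_eq, hcast d, hcast e, kummerProdCoeff_eq]
      ring
  · obtain ⟨h1, h2⟩ := weighted_exp_mul_kummer_mul_kummer (a := α) (m := m) (by norm_num)
      (by norm_num) (factorialBound_poch_div_poch_mul_pow d e x (δ := 1 / 4) (by norm_num)) h2β
    exact ⟨by rw [tripleTerm_eq]; exact h1,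
      by rw [kdf, kdfTerm_neg_eq, triple, tripleTerm_eq]; exact h2⟩
  · obtain ⟨t, hxt, ht0, ht⟩ := hhalf x hx
    obtain ⟨h1, h2⟩ := weighted_kummer_mul_kummer
      (w := fun N => poch d N * x ^ N) (κ := fun M => poch d M * x ^ M)
      (poch_mul_pow_add d x) ht0 ht (hN x t hxt)
      h2α h2β hα hα' hβ hβ' hαβ
    refine ⟨by rw [kdfTerm_nil_eq]; exact h1, fun j _ k _ => ?_, ?_⟩
    · rw [srivastavaTerm_nil_eq, hcast d]
      exact (weighted_exp_mul_besselProdSeries _ _ _ ht0 ht (hN x t hxt (j + k))).1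
    · rw [kdf, kdfTerm_nil_eq, h2]
      refine Finset.sum_congr rfl fun j _ => Finset.sum_congr rfl fun k _ => ?_
      rw [srivastavaS, srivastavaTerm_nil_eq, hcast d, kummerProdCoeff_eq]
      ring
  · obtain ⟨t, hxt, ht0, ht⟩ := hhalf x hx
    obtain ⟨h1, h2⟩ := weighted_kummer_mul_rescale
      (w := fun N => poch d N * x ^ N) (κ := fun M => poch d M * x ^ M)
      (poch_mul_pow_add d x) ht0 ht (hN x t hxt)
      h2α h2β hα hα' hβ hβ' hαβ
    refine ⟨by rw [kdfTerm_nil_neg_eq]; exact h1, fun j _ k _ => ?_, ?_⟩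
    · rw [genHypTerm_nil_eq, hcast d]
      exact (weighted_besselProdSeries _ _ _ ht0 ht (hN x t hxt (j + k))).1
    · rw [kdf, kdfTerm_nil_neg_eq, h2]
      refine Finset.sum_congr rfl fun j _ => Finset.sum_congr rfl fun k _ => ?_
      rw [genHyp, genHypTerm_nil_eq, hcast d, kummerProdCoeff_eq]
      ring
  · obtain ⟨t, hxt, ht⟩ := exists_between hx
    obtain ⟨h1, h2⟩ := weighted_exp_mul_kummer_mul_kummer (a := α) (m := m)
      ((norm_nonneg x).trans hxt.le) (by linarith) (factorialBound_poch_mul_pow d x hxt) h2β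
    exact ⟨by rw [tripleTerm_nil_eq]; exact h1,
      by rw [kdf, kdfTerm_nil_neg_eq, triple, tripleTerm_nil_eq]; exact h2⟩
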